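/- **Setting.** Let $T>0$ and let $\Gamma(t)=\Phi(\Gamma_0,t)\subset\mathbb R^3$, $t\in[0,T]$, be a $C^2$ evolving closed connected surface, with $\Phi(\cdot,0)=\mathrm{id}$ and $\partial_t\Phi(x,t)=V(\Phi(x,t),t)$ for a velocity field $V\in C^1([0,T];C^2(\mathbb R^3;\mathbb R^3))$. Let $\varepsilon>0$, $\theta\in(0,1)$, and $$F(r)=\tfrac{\theta}{2}F_{\log}(r)+\tfrac{1-r^2}{2},\quad F_{\log}(r)=(1-r)\log(1-r)+(1+r)\log(1+r),\quad f(r)=F_{\log}'(r)=\log\tfrac{1+r}{1-r}.$$ *Triangulations.* A triangulation with nodes on $\Gamma_0$ is transported by letting its nodes move with velocity $V$; this gives triangles $K(t)\in\mathcal T_h(t)$ and $\Gamma_h(t)=\bigcup K(t)$. Set $h=\sup_{t}\max_{K}\operatorname{diam}K(t)$. Fix $\rho>0$. We call the evolving triangulation admissible (with constant $\rho$) if for all $t\in[0,T]$: the triangles are nondegenerate and conforming; each $K(t)$ contains two-dimensional balls with supremal diameter at least $\rho h$; $\Gamma_h(t)$ lies in a tubular neighbourhood of $\Gamma(t)$ and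 the normal projection maps it bijectively onto $\Gamma(t)$ (exactness); all angles are at most $\pi/2$; and $\nabla_{\Gamma_h}\cdot V_h\ge0$, where $V_h$ is the piecewise linear nodal interpolant of $V$. *Discrete forms.* Let $S_h(t)$ be the continuous functions on $\Gamma_h(t)$ that are affine on each triangle, $I_h$ the nodal interpolation, and $$\bar m_h(t;\eta,\zeta)=\int_{\Gamma_h(t)}I_h(\eta\zeta),\qquad a_h(t;\eta,\zeta)=\int_{\Gamma_h(t)}\nabla_{\Gamma_h}\eta\cdot\nabla_{\Gamma_h}\zeta .$$ For $z\in S_h(t)$ with $\int_{\Gamma_h(t)}z=0$ let $\bar{\mathcal G}z\in S_h(t)$ be the function with $a_h(t;\bar{\mathcal G}z,\phi)=\bar m_h(t;z,\phi)$ for all $\phi\in S_h(t)$ and $\int_{\Gamma_h(t)}\bar{\mathcal G}z=0$, and put $\|z\|_{-h}^2=a_h(t;\bar{\mathcal G}z,\bar{\mathcal G}z)$. *Scheme.* Let $\tau>0$ with $N_T=T/\tau\in\mathbb N$, $t_n=n\tau$, $\Gamma_h^n=\Gamma_h(t_n)$, $S_h^n=S_h(t_n)$. For $\phi^n\in S_h^n$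 let $\underline{\phi^n}\in S_h^{n-1}$ be the function with the same nodal values; for $\phi^{n-1}\in S_h^{n-1}$ let $\overline{\phi^{n-1}}\in S_h^n$ be the function with the same nodal values, and $\partial^\bullet_\tau\phi^n=\frac1\tau(\phi^n-\overline{\phi^{n-1}})$. The set of admissible initial data is $$\mathcal I_{h,0}=\Big\{\eta\in S_h(0):\ |\eta|\le1\text{ a.e.},\ \int_{\Gamma_h(0)}\tfrac{\varepsilon}{2}|\nabla_{\Gamma_h}\eta|^2+\tfrac1\varepsilon I_hF(\eta)<\infty,\ \Big|\tfrac{1}{|\Gamma_h(0)|}\int_{\Gamma_h(0)}\eta\Big|<1\Big\}.$$ A solution pair with initial datum $U_{h,0}\in\mathcal I_{h,0}$ is a sequence $(U_h^n,W_h^n)\in S_h^n\times S_h^n$, $1\le n\le N_T$, with $|U_h^n|<1$ on $\Gamma_h^n$ and $U_h^0=U_{h,0}$, such that for all $1\le n\le N_T$, $\phi^{n-1}\in S_h^{n-1}$, $\phi^n\in S_h^n$, $$\tfrac1\tau\big(\bar m_h(t_n;U_h^n,\phi^n)-\bar m_h(t_{n-1};U_h^{n-1},\phi^{n-1})\big)+a_h(t_n;W_h^n,\phi^n)=\bar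 m_h(t_{n-1};U_h^{n-1},\underline{\partial^\bullet_\tau\phi^n}),$$ $$\bar m_h(t_n;W_h^n,\phi^n)=\varepsilon a_h(t_n;U_h^n,\phi^n)+\tfrac{\theta}{2\varepsilon}\bar m_h(t_n;I_hf(U_h^n),\phi^n)-\tfrac1\varepsilon\bar m_h(t_n;U_h^n,\phi^n).$$ **Proposition.** There is a constant $C>0$, depending only on the evolving surface ($\Gamma_0,\Phi,V,T$) and on $\varepsilon,\theta,\rho$, such that the following holds for every admissible evolving triangulation with constant $\rho$ and every $\tau>0$ with $T/\tau\in\mathbb N$ and $\tau<\varepsilon^3$. Let $U_{h,0}^1,U_{h,0}^2\in\mathcal I_{h,0}$ have equal mean over $\Gamma_h(0)$, and let $(U_h^{n,i},W_h^{n,i})$ be corresponding solution pairs, $i=1,2$. Then $\bar{\mathcal G}(U_h^{n,1}-U_h^{n,2})$ exists and is unique for $0\le n\le N_T$, and for all $1\le N\le N_T$ $$\|U_h^{N,1}-U_h^{N,2}\|_{-h}^2+\frac{\varepsilon^4\tau}{\varepsilon^3-\tau}\sum_{n=1}^N\|\nabla_{\Gamma_h}(U_h^{n,1}-U_h^{n,2})\|_{L^2(\Gamma_h^n)}^2\le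 e^{Ct_N}\,\frac{\varepsilon^3}{\varepsilon^3-\tau}\,\|U_{h,0}^1-U_{h,0}^2\|_{-h}^2 .$$ -/

import Mathlib

open Set MeasureTheory
open scoped MeasureTheory RealInnerProductSpace

noncomputable section

namespace ESFEM

/-- Ambient space `ℝ³` with its Euclidean structure. -/
abbrev E3 : Type := EuclideanSpace ℝ (Fin 3)

/-! ### Evolving surfaces -/

/-- Closed (compact, without boundary), connected, embedded `C²` surface in `ℝ³`: locally a regular
level set of a `C²` function. (Such a surface is automatically orientable.) -/
structure IsClosedC2Surface (Γ : Set E3) : Prop where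
  isCompact : IsCompact Γ
  isConnected : IsConnected Γ
  level : ∀ x ∈ Γ, ∃ (U : Set E3) (g : E3 → ℝ), IsOpen U ∧ x ∈ U ∧ ContDiffOn ℝ 2 g U ∧
    (∀ y ∈ U, fderiv ℝ g y ≠ 0) ∧ Γ ∩ U = {y | y ∈ U ∧ g y = 0}

/-- `V ∈ C¹([0,T]; C²(ℝ³;ℝ³))`: all spatial derivatives of order at most two exist, are
differentiable in time with derivative those of a field `V'`, and everything is continuous
in `(t,x)`. -/
def IsC1C2 (T : ℝ) (V : ℝ → E3 → E3) : Prop :=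
  ∃ V' : ℝ → E3 → E3,
    (∀ t ∈ Icc 0 T, ContDiff ℝ 2 (V t) ∧ ContDiff ℝ 2 (V' t)) ∧
    ∀ j : ℕ, j ≤ 2 →
      ContinuousOn (fun q : ℝ × E3 => iteratedFDeriv ℝ j (V q.1) q.2) (Icc 0 T ×ˢ univ) ∧
      ContinuousOn (fun q : ℝ × E3 => iteratedFDeriv ℝ j (V' q.1) q.2) (Icc 0 T ×ˢ univ) ∧
      ∀ t ∈ Icc 0 T, ∀ x : E3,
        HasDerivWithinAt (fun s => iteratedFDeriv ℝ j (V s) x) (iteratedFDeriv ℝ j (V' t) x)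
          (Icc 0 T) t

/-- A `C²` evolving surface `Γ(t) = Φ(Γ₀, t)`, `t ∈ [0,T]`, transported by the velocity field `V`.
Only the values of `Φ` on `[0,T] × Γ₀` and of `V` on `[0,T] × ℝ³` matter. -/
structure EvolvingSurface where
  T : ℝ
  T_pos : 0 < T
  Γ₀ : Set E3
  isSurface : IsClosedC2Surface Γ₀
  Φ : ℝ → E3 → E3
  V : ℝ → E3 → E3
  contDiff_Φ : ContDiffOn ℝ 2 (fun q : ℝ × E3 => Φ q.1 q.2) (Icc 0 T ×ˢ Γ₀)
  diffeo : ∀ t ∈ Icc 0 T, ∃ Ψ : E3 → E3, ContDiffOn ℝ 2 Ψ (Φ t '' Γ₀) ∧ ∀ x ∈ Γ₀, Ψ (Φ t x) = x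
  Φ_zero : ∀ x ∈ Γ₀, Φ 0 x = x
  contDiff_V : IsC1C2 T V
  flow : ∀ x ∈ Γ₀, ∀ t ∈ Icc 0 T,
    HasDerivWithinAt (fun s => Φ s x) (V t (Φ t x)) (Icc 0 T) t

/-- The surface `Γ(t)`. -/
def EvolvingSurface.surface (S : EvolvingSurface) (t : ℝ) : Set E3 := S.Φ t '' S.Γ₀

/-- `{x | dist(x, Γ) < r}` is a tubular neighbourhood of `Γ`: each of its points has a unique
closest point on `Γ`. -/
def IsTubeRadius (Γ : Set E3) (r : ℝ) : Prop :=
  0 < r ∧ ∀ x : E3, Metric.infDist x Γ < r → ∃! p, p ∈ Γ ∧ dist x p = Metric.infDist x Γ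

open Classical in
/-- The normal (closest point) projection onto `Γ`. -/
def normalProj (Γ : Set E3) (x : E3) : E3 :=
  if h : ∃ p, p ∈ Γ ∧ dist x p = Metric.infDist x Γ then h.choose else x

/-! ### Evolving triangulations -/

/-- Combinatorial data of an evolving triangulation: initial nodes on `Γ₀` and triangles, given by
three nodes each. The nodes are transported by the flow. -/
structure EvolvingMesh (S : EvolvingSurface) where
  numNodes : ℕ
  node₀ : Fin numNodes → E3
  node₀_mem : ∀ i, node₀ i ∈ S.Γ₀
  node₀_injective : Function.Injective node₀
  tris : Finset (Finset (Fin numNodes))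
  card_tris : ∀ K ∈ tris, K.card = 3
  exists_tri : ∀ i, ∃ K ∈ tris, i ∈ K

namespace EvolvingMesh

variable {S : EvolvingSurface} (M : EvolvingMesh S)

/-- The node `x_i(t)`. It solves `x_i' = V(x_i, t)` with `x_i(0)` the initial node. -/
def node (t : ℝ) (i : Fin M.numNodes) : E3 := S.Φ t (M.node₀ i)

/-- The vertices of the triangle `K(t)`. -/
def verts (t : ℝ) (K : Finset (Fin M.numNodes)) : Set E3 := M.node t '' (K : Set (Fin M.numNodes))

/-- The closed triangle `K(t)`. -/
def tri (t : ℝ) (K : Finset (Fin M.numNodes)) : Set E3 := convexHull ℝ (M.verts t K)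

/-- The triangulated surface `Γ_h(t)`. -/
def surface (t : ℝ) : Set E3 := ⋃ K ∈ M.tris, M.tri t K

/-- The mesh size `h = sup_t max_K diam K(t)`. -/
def meshSize : ℝ := sSup {d | ∃ t ∈ Icc 0 S.T, ∃ K ∈ M.tris, d = Metric.diam (M.tri t K)}

/-- `ρ_{K(t)}`: the supremum of the diameters of two-dimensional balls contained in `K(t)`. -/
def inDiam (t : ℝ) (K : Finset (Fin M.numNodes)) : ℝ :=
  sSup {d | ∃ c ∈ affineSpan ℝ (M.verts t K), ∃ r : ℝ, 0 ≤ r ∧ d = 2 * r ∧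
    Metric.closedBall c r ∩ (affineSpan ℝ (M.verts t K) : Set E3) ⊆ M.tri t K}

/-! ### Finite element functions

A function on `Γ_h(t)` is represented by a function on `ℝ³`; elements of `S_h(t)` are extended by
zero outside `Γ_h(t)`, so that they are determined by their values on `Γ_h(t)`. -/

/-- `S_h(t)`: continuous functions on `Γ_h(t)` that are affine on every triangle. -/
def feSpace (t : ℝ) : Submodule ℝ (E3 → ℝ) where
  carrier := {φ | ContinuousOn φ (M.surface t) ∧
    (∀ K ∈ M.tris, ∃ A : E3 →ᵃ[ℝ] ℝ, EqOn φ A (M.tri t K)) ∧ ∀ x ∉ M.surface t, φ x = 0}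
  add_mem' := by
    rintro φ ψ ⟨h1, h2, h3⟩ ⟨k1, k2, k3⟩
    refine ⟨h1.add k1, fun K hK => ?_, fun x hx => by simp [h3 x hx, k3 x hx]⟩
    obtain ⟨A, hA⟩ := h2 K hK
    obtain ⟨B, hB⟩ := k2 K hK
    exact ⟨A + B, fun x hx => by simp [hA hx, hB hx]⟩
  zero_mem' := ⟨continuousOn_const, fun _ _ => ⟨0, fun _ _ => rfl⟩, fun _ _ => rfl⟩
  smul_mem' := by
    rintro c φ ⟨h1, h2, h3⟩
    refine ⟨h1.const_smul c, fun K hK => ?_, fun x hx => by simp [h3 x hx]⟩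
    obtain ⟨A, hA⟩ := h2 K hK
    exact ⟨c • A, fun x hx => by simp [hA hx]⟩

/-- `w` is the vector of barycentric coordinates of the point `x` of `Γ_h(t)`. -/
def IsBary (t : ℝ) (x : E3) (w : Fin M.numNodes → ℝ) : Prop :=
  (∀ i, 0 ≤ w i) ∧ ∑ i, w i = 1 ∧ (∃ K ∈ M.tris, ∀ i ∉ K, w i = 0) ∧ ∑ i, w i • M.node t i = x

open Classical in
/-- The nodal basis function `φ_i(t)` at `x`, i.e. the barycentric coordinate of `x` with respect
to the `i`-th node (zero outside `Γ_h(t)`). -/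
def hat (t : ℝ) (i : Fin M.numNodes) (x : E3) : ℝ :=
  if h : ∃ w, M.IsBary t x w then h.choose i else 0

/-- The element of `S_h(t)` with nodal values `c`. -/
def ofNodal (t : ℝ) (c : Fin M.numNodes → ℝ) (x : E3) : ℝ := ∑ i, c i * M.hat t i x

/-- The Lagrange interpolant `I_h z` on `Γ_h(t)`. -/
def interp (t : ℝ) (z : E3 → ℝ) : E3 → ℝ := M.ofNodal t fun i => z (M.node t i)

/-- For a function `φ` on `Γ_h(s)`, the finite element function on `Γ_h(t)` with the same nodal
values. With `s = t_n`, `t = t_{n-1}` this is the underline, with `s = t_{n-1}`, `t = t_n` the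
overline operation. -/
def transfer (s t : ℝ) (φ : E3 → ℝ) : E3 → ℝ := M.ofNodal t fun i => φ (M.node s i)

/-- `g` is the (constant) tangential gradient on `K(t)` of a function `φ` that is affine on
`K(t)`. -/
def IsElemGrad (t : ℝ) (K : Finset (Fin M.numNodes)) (φ : E3 → ℝ) (g : E3) : Prop :=
  g ∈ vectorSpan ℝ (M.verts t K) ∧ ∀ x ∈ M.tri t K, ∀ y ∈ M.tri t K, φ y - φ x = ⟪g, y - x⟫

theorem existsUnique_isElemGrad (t : ℝ) (K : Finset (Fin M.numNodes)) {φ : E3 → ℝ}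
    {A : E3 →ᵃ[ℝ] ℝ} (hA : EqOn φ A (M.tri t K)) : ∃! g, M.IsElemGrad t K φ g := by
  have hsub : ∀ x ∈ M.tri t K, ∀ y ∈ M.tri t K, y - x ∈ vectorSpan ℝ (M.verts t K) := by
    intro x hx y hy
    rw [← direction_affineSpan]
    exact AffineSubspace.vsub_mem_direction (convexHull_subset_affineSpan _ hy)
      (convexHull_subset_affineSpan _ hx)
  let a : E3 := (InnerProductSpace.toDual ℝ E3).symm (LinearMap.toContinuousLinearMap A.linear)
  refine ⟨(vectorSpan ℝ (M.verts t K)).starProjection a,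
    ⟨Submodule.starProjection_apply_mem _ _, fun x hx y hy => ?_⟩, ?_⟩
  · have h1 : A y - A x = A.linear (y - x) := (A.linearMap_vsub y x).symm
    have h2 : ⟪a, y - x⟫ = A.linear (y - x) := by simp [a]
    rw [hA hx, hA hy, h1, ← h2, Submodule.inner_starProjection_left_eq_right,
      Submodule.starProjection_eq_self_iff.2 (hsub x hx y hy)]
  · rintro g ⟨hg, hg'⟩
    set p := (vectorSpan ℝ (M.verts t K)).starProjection a
    have hp : p ∈ vectorSpan ℝ (M.verts t K) := Submodule.starProjection_apply_mem _ _
    have hp' : ∀ x ∈ M.tri t K, ∀ y ∈ M.tri t K, φ y - φ x = ⟪p, y - x⟫ := by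
      intro x hx y hy
      have h1 : A y - A x = A.linear (y - x) := (A.linearMap_vsub y x).symm
      have h2 : ⟪a, y - x⟫ = A.linear (y - x) := by simp [a]
      rw [hA hx, hA hy, h1, ← h2, Submodule.inner_starProjection_left_eq_right,
        Submodule.starProjection_eq_self_iff.2 (hsub x hx y hy)]
    have hle : vectorSpan ℝ (M.verts t K) ≤ (ℝ ∙ (g - p))ᗮ := by
      rw [vectorSpan_def, Submodule.span_le]
      rintro _ ⟨y, hy, x, hx, rfl⟩
      rw [SetLike.mem_coe, Submodule.mem_orthogonal_singleton_iff_inner_right, inner_sub_left]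
      have h1 := hg' x (subset_convexHull ℝ _ hx) y (subset_convexHull ℝ _ hy)
      have h2 := hp' x (subset_convexHull ℝ _ hx) y (subset_convexHull ℝ _ hy)
      simp only [vsub_eq_sub]
      linarith
    have := Submodule.mem_orthogonal_singleton_iff_inner_right.1 (hle (sub_mem hg hp))
    exact sub_eq_zero.1 (inner_self_eq_zero.1 this)

open Classical in
/-- The tangential gradient of `φ` on the triangle `K(t)`. -/
def elemGrad (t : ℝ) (K : Finset (Fin M.numNodes)) (φ : E3 → ℝ) : E3 :=
  if h : ∃ g, M.IsElemGrad t K φ g then h.choose else 0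

/-- The discrete velocity `V_h`. -/
def velocity (t : ℝ) (x : E3) : E3 := ∑ i, M.hat t i x • S.V t (M.node t i)

/-- The (constant) tangential divergence of `V_h` on `K(t)`. -/
def elemDiv (t : ℝ) (K : Finset (Fin M.numNodes)) : ℝ :=
  ∑ k : Fin 3, M.elemGrad t K (fun x => M.velocity t x k) k

/-- The assumptions on the evolving triangulation. -/
structure IsAdmissible (ρ : ℝ) : Prop where
  /-- the triangles do not degenerate -/
  affineIndependent : ∀ t ∈ Icc 0 S.T, ∀ K ∈ M.tris,
    AffineIndependent ℝ (fun i : {i // i ∈ K} => M.node t i)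
  /-- two triangles meet in a common edge, in a common node, or not at all -/
  conforming : ∀ t ∈ Icc 0 S.T, ∀ K ∈ M.tris, ∀ K' ∈ M.tris,
    M.tri t K ∩ M.tri t K' = M.tri t (K ∩ K')
  quasiUniform : ∀ t ∈ Icc 0 S.T, ∀ K ∈ M.tris, ρ * M.meshSize ≤ M.inDiam t K
  /-- `Γ_h(t)` lies in a tubular neighbourhood of `Γ(t)` -/
  tubular : ∀ t ∈ Icc 0 S.T, ∃ r, IsTubeRadius (S.surface t) r ∧
    ∀ x ∈ M.surface t, Metric.infDist x (S.surface t) < r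
  /-- exactness: the lifted triangles form a conforming subdivision of `Γ(t)` -/
  exact : ∀ t ∈ Icc 0 S.T, BijOn (normalProj (S.surface t)) (M.surface t) (S.surface t)
  acute : ∀ t ∈ Icc 0 S.T, ∀ K ∈ M.tris, ∀ i ∈ K, ∀ j ∈ K, ∀ k ∈ K, i ≠ j → k ≠ j →
    EuclideanGeometry.angle (M.node t i) (M.node t j) (M.node t k) ≤ Real.pi / 2
  div_nonneg : ∀ t ∈ Icc 0 S.T, ∀ K ∈ M.tris, 0 ≤ M.elemDiv t K

/-! ### Bilinear forms and norms -/

/-- The integral of `f` over `Γ_h(t)` with respect to surface area. -/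
def integral (t : ℝ) (f : E3 → ℝ) : ℝ := ∫ x in M.surface t, f x ∂μHE[2]

/-- The mean value of `f` over `Γ_h(t)`. -/
def mean (t : ℝ) (f : E3 → ℝ) : ℝ :=
  M.integral t f / (μHE[2] : Measure E3).real (M.surface t)

/-- The lumped mass form `m̄_h(t; η, ζ)`. -/
def lumped (t : ℝ) (η ζ : E3 → ℝ) : ℝ := M.integral t (M.interp t fun x => η x * ζ x)

/-- The Dirichlet form `a_h(t; η, ζ)`, the integral of `∇η · ∇ζ` with elementwise gradients. -/
def dirichlet (t : ℝ) (η ζ : E3 → ℝ) : ℝ :=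
  ∑ K ∈ M.tris, ∫ _x in M.tri t K, ⟪M.elemGrad t K η, M.elemGrad t K ζ⟫ ∂μHE[2]

/-- `‖∇u‖²` in `L²(Γ_h(t))`. -/
def gradNormSq (t : ℝ) (u : E3 → ℝ) : ℝ := M.dirichlet t u u

/-- `G` is the mass-lumped inverse Laplacian of `z` on `S_h(t)`. -/
def IsInvLap (t : ℝ) (z G : E3 → ℝ) : Prop :=
  G ∈ M.feSpace t ∧ (∀ φ ∈ M.feSpace t, M.dirichlet t G φ = M.lumped t z φ) ∧ M.integral t G = 0

open Classical in
/-- The mass-lumped inverse Laplacian. -/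
def invLap (t : ℝ) (z : E3 → ℝ) : E3 → ℝ :=
  if h : ∃ G, M.IsInvLap t z G then h.choose else 0

/-- The squared discrete negative norm `‖z‖²_{-h}` on `S_h(t)`. -/
def negNormSq (t : ℝ) (z : E3 → ℝ) : ℝ := M.dirichlet t (M.invLap t z) (M.invLap t z)

/-! ### The Cahn–Hilliard scheme -/

end EvolvingMesh

/-- `F_log(r) = (1-r) log(1-r) + (1+r) log(1+r)` on `[-1,1]`, with `0 log 0 = 0`. -/
def Flog (r : ℝ) : ℝ := (1 - r) * Real.log (1 - r) + (1 + r) * Real.log (1 + r)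

/-- The logarithmic potential on `[-1,1]`. -/
def potential (θ r : ℝ) : ℝ := θ / 2 * Flog r + (1 - r ^ 2) / 2

/-- `f = F_log'` on `(-1,1)`. -/
def fLog (r : ℝ) : ℝ := Real.log ((1 + r) / (1 - r))

namespace EvolvingMesh

variable {S : EvolvingSurface} (M : EvolvingMesh S)

/-- The discrete Ginzburg–Landau energy of a function with values in `[-1,1]` (its density is then
nonnegative). -/
def energy (ε θ t : ℝ) (u : E3 → ℝ) : ENNReal :=
  ∑ K ∈ M.tris, ∫⁻ x in M.tri t K, ENNReal.ofReal
    (ε / 2 * ‖M.elemGrad t K u‖ ^ 2 + 1 / ε * M.interp t (fun y => potential θ (u y)) x) ∂μHE[2]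

/-- The set of admissible discrete initial data. -/
def initialData (ε θ : ℝ) : Set (E3 → ℝ) :=
  {η | η ∈ M.feSpace 0 ∧ (∀ᵐ x ∂(μHE[2] : Measure E3).restrict (M.surface 0), |η x| ≤ 1) ∧
    M.energy ε θ 0 η < ⊤ ∧ |M.mean 0 η| < 1}

/-- `(U^n, W^n)`, `n = 0, …, NT`, solves the fully discrete scheme with time step `τ`, `t_n = n τ`,
and initial datum `U₀`. The condition `|U^n| < 1`, `n ≥ 1`, is what makes `f(U^n)` meaningful.
The value `W^0` plays no role. -/
structure IsSolution (ε θ τ : ℝ) (NT : ℕ) (U₀ : E3 → ℝ) (U W : ℕ → E3 → ℝ) : Prop where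
  initial : U 0 = U₀
  mem_U : ∀ n : ℕ, 1 ≤ n → n ≤ NT → U n ∈ M.feSpace (n * τ)
  mem_W : ∀ n : ℕ, 1 ≤ n → n ≤ NT → W n ∈ M.feSpace (n * τ)
  abs_lt_one : ∀ n : ℕ, 1 ≤ n → n ≤ NT → ∀ x ∈ M.surface (n * τ), |U n x| < 1
  eqn_U : ∀ n : ℕ, 1 ≤ n → n ≤ NT →
    ∀ φ' ∈ M.feSpace ((n - 1 : ℕ) * τ), ∀ φ ∈ M.feSpace (n * τ),
      1 / τ * (M.lumped (n * τ) (U n) φ - M.lumped ((n - 1 : ℕ) * τ) (U (n - 1)) φ')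
          + M.dirichlet (n * τ) (W n) φ
        = M.lumped ((n - 1 : ℕ) * τ) (U (n - 1))
            (M.transfer (n * τ) ((n - 1 : ℕ) * τ)
              ((1 / τ) • (φ - M.transfer ((n - 1 : ℕ) * τ) (n * τ) φ')))
  eqn_W : ∀ n : ℕ, 1 ≤ n → n ≤ NT → ∀ φ ∈ M.feSpace (n * τ),
      M.lumped (n * τ) (W n) φ
        = ε * M.dirichlet (n * τ) (U n) φ
          + θ / (2 * ε) * M.lumped (n * τ) (M.interp (n * τ) fun x => fLog (U n x)) φ
          - 1 / ε * M.lumped (n * τ) (U n) φ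

end EvolvingMesh

end ESFEM

end

/-! The estimate is an energy argument in the discrete negative norm. Let z^n be the difference of
the two order parameters and w^n that of the chemical potentials. Testing the scheme with constants
shows that z^n keeps mean zero, so G^n, its inverse Laplacian, exists. Its uniqueness rests on
connectedness of the triangulated surface, which is inherited from Γ(t) through the bijective normal
projection: a finite element function of zero Dirichlet energy is then constant.

Testing the difference of the first equations with G^n gives ‖z^n‖²_{-h}, a cross term with z^{n-1}
at the old time, and τ m̄(z^n, w^n). The second equation turns the last into ε‖∇z^n‖², a logarithmic
term that is nonnegative because f is increasing, and -(1/ε) m̄(z^n, z^n). This negative term equals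
-(1/ε) a_h(G^n, z^n) and is absorbed by Young's inequality. The cross term is a_h(G^{n-1},
underlined G^n) at time t_{n-1}, so the Dirichlet energies of functions with the same nodal values
must be compared at consecutive times. `step_estimate` collects these terms.

The comparison is geometric. The field V is Lipschitz on a ball containing all meshes, and shape
regularity bounds the weights of an in-plane vector by its length over ρh. Hence vectors moving with
a triangle change at a relative rate κ independent of h (`exists_isStrainBound`). Gronwall's
inequality then controls areas and elementwise gradients, giving the factor exp(4κτ) in
`dirichlet_transfer_le`.

Each step thus costs α exp(4κτ), where α = ε³/(ε³-τ). Since T/τ is an integer, ε³-τ is at least some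
δ depending only on T and ε (`exists_timeStep_gap`). Therefore α ≤ exp(τ/δ), and iteration yields
the exponential bound with C = 4κ + 1/δ. -/

namespace ESFEM

namespace EvolvingMesh

variable {S : EvolvingSurface} {M : EvolvingMesh S} {ρ t : ℝ} {K : Finset (Fin M.numNodes)}

/-! ### Barycentric coordinates and nodal basis functions -/

theorem mem_tri_iff {x : E3} : x ∈ M.tri t K ↔ ∃ w : Fin M.numNodes → ℝ,
    (∀ i, 0 ≤ w i) ∧ ∑ i, w i = 1 ∧ (∀ i ∉ K, w i = 0) ∧ ∑ i, w i • M.node t i = x := by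
  classical
  constructor
  · intro hx
    refine convexHull_min (t := {x : E3 | ∃ w : Fin M.numNodes → ℝ,
      (∀ i, 0 ≤ w i) ∧ ∑ i, w i = 1 ∧ (∀ i ∉ K, w i = 0) ∧ ∑ i, w i • M.node t i = x}) ?_ ?_ hx
    · rintro _ ⟨i, hi, rfl⟩
      refine ⟨Pi.single i 1, fun j => ?_, by simp, fun j hj => ?_, ?_⟩
      · by_cases h : j = i <;> simp [h]
      · have : j ≠ i := fun h => hj (h ▸ hi)
        simp [this]
      · simp [Pi.single_apply, ite_smul]
    · rintro x ⟨w, h0, h1, hK, rfl⟩ y ⟨v, k0, k1, kK, rfl⟩ a b ha hb hab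
      refine ⟨fun i => a * w i + b * v i, fun i => ?_, ?_, fun i hi => ?_, ?_⟩
      · have := mul_nonneg ha (h0 i)
        have := mul_nonneg hb (k0 i)
        linarith
      · rw [Finset.sum_add_distrib, ← Finset.mul_sum, ← Finset.mul_sum, h1, k1]
        simpa using hab
      · simp [hK i hi, kK i hi]
      · simp only [add_smul, Finset.sum_add_distrib, Finset.smul_sum, smul_smul]
  · rintro ⟨w, h0, h1, hK, rfl⟩
    have e1 : ∑ i, w i • M.node t i = ∑ i ∈ K, w i • M.node t i :=
      (Finset.sum_subset (Finset.subset_univ K) fun i _ hi => by simp [hK i hi]).symm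
    have e2 : ∑ i ∈ K, w i = 1 := by
      rw [← h1]; exact Finset.sum_subset (Finset.subset_univ K) fun i _ hi => hK i hi
    rw [e1]
    exact (convex_convexHull ℝ _).sum_mem (fun i _ => h0 i) e2
      fun i hi => subset_convexHull ℝ _ ⟨i, hi, rfl⟩

theorem node_mem_tri {i : Fin M.numNodes} (hi : i ∈ K) : M.node t i ∈ M.tri t K :=
  subset_convexHull ℝ _ ⟨i, hi, rfl⟩

theorem tri_subset_surface (hK : K ∈ M.tris) : M.tri t K ⊆ M.surface t :=
  fun _ hx => mem_iUnion₂.2 ⟨K, hK, hx⟩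

theorem node_mem_surface (i : Fin M.numNodes) : M.node t i ∈ M.surface t := by
  obtain ⟨K, hK, hi⟩ := M.exists_tri i
  exact tri_subset_surface hK (node_mem_tri hi)

theorem isCompact_tri : IsCompact (M.tri t K) :=
  (K.finite_toSet.image _).isCompact_convexHull ℝ

theorem isCompact_surface : IsCompact (M.surface t) :=
  M.tris.isCompact_biUnion fun _ _ => isCompact_tri

theorem exists_isBary {x : E3} (hx : x ∈ M.surface t) : ∃ w, M.IsBary t x w := by
  obtain ⟨K, hK, hx⟩ := mem_iUnion₂.1 hx
  obtain ⟨w, h0, h1, h2, h3⟩ := mem_tri_iff.1 hx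
  exact ⟨w, h0, h1, ⟨K, hK, h2⟩, h3⟩

theorem IsBary.mem_surface {x : E3} {w : Fin M.numNodes → ℝ} (h : M.IsBary t x w) :
    x ∈ M.surface t := by
  obtain ⟨h0, h1, ⟨K, hK, h2⟩, h3⟩ := h
  exact tri_subset_surface hK (mem_tri_iff.2 ⟨w, h0, h1, h2, h3⟩)

namespace IsAdmissible

theorem eq_zero_of_sum (hM : M.IsAdmissible ρ) (ht : t ∈ Icc 0 S.T) (hK : K ∈ M.tris)
    {c : Fin M.numNodes → ℝ} (hc : ∀ i ∉ K, c i = 0) (h0 : ∑ i, c i = 0)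
    (h1 : ∑ i, c i • M.node t i = 0) : c = 0 := by
  have e1 : ∑ i : {i // i ∈ K}, c i • M.node t i = 0 := by
    rw [Finset.sum_coe_sort K fun i => c i • M.node t i, ← h1]
    exact Finset.sum_subset (Finset.subset_univ K) fun i _ hi => by simp [hc i hi]
  have e2 : ∑ i : {i // i ∈ K}, c i = 0 := by
    rw [Finset.sum_coe_sort K c, ← h0]
    exact Finset.sum_subset (Finset.subset_univ K) fun i _ hi => hc i hi
  have := affineIndependent_iff.1 (hM.affineIndependent t ht K hK) Finset.univ
    (fun i => c i.1) e2 e1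
  funext i
  by_cases hi : i ∈ K
  · exact this ⟨i, hi⟩ (Finset.mem_univ _)
  · exact hc i hi

theorem bary_unique (hM : M.IsAdmissible ρ) (ht : t ∈ Icc 0 S.T) (hK : K ∈ M.tris)
    {w v : Fin M.numNodes → ℝ} (hw : ∀ i ∉ K, w i = 0) (hv : ∀ i ∉ K, v i = 0)
    (h0 : ∑ i, w i = ∑ i, v i) (h1 : ∑ i, w i • M.node t i = ∑ i, v i • M.node t i) : w = v := by
  refine sub_eq_zero.1 (hM.eq_zero_of_sum ht hK (c := w - v) (fun i hi => ?_) ?_ ?_)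
  · simp [hw i hi, hv i hi]
  · simp [h0]
  · simp [sub_smul, h1]

/-- If x lies in two triangles, conformity places it in the hull of their common nodes. Coordinates
supported there agree with both given ones, by affine independence in each triangle separately. -/
theorem isBary_unique (hM : M.IsAdmissible ρ) (ht : t ∈ Icc 0 S.T) {x : E3}
    {w v : Fin M.numNodes → ℝ} (hw : M.IsBary t x w) (hv : M.IsBary t x v) : w = v := by
  obtain ⟨w0, w1, ⟨K, hK, w2⟩, w3⟩ := hw
  obtain ⟨v0, v1, ⟨K', hK', v2⟩, v3⟩ := hv
  have hx : x ∈ M.tri t (K ∩ K') := by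
    rw [← hM.conforming t ht K hK K' hK']
    exact ⟨mem_tri_iff.2 ⟨w, w0, w1, w2, w3⟩, mem_tri_iff.2 ⟨v, v0, v1, v2, v3⟩⟩
  obtain ⟨u, u0, u1, u2, u3⟩ := mem_tri_iff.1 hx
  have e1 := hM.bary_unique ht hK w2 (fun i hi => u2 i fun h => hi (Finset.mem_inter.1 h).1)
    (w1.trans u1.symm) (w3.trans u3.symm)
  have e2 := hM.bary_unique ht hK' v2 (fun i hi => u2 i fun h => hi (Finset.mem_inter.1 h).2)
    (v1.trans u1.symm) (v3.trans u3.symm)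
  rw [e1, e2]

theorem hat_eq (hM : M.IsAdmissible ρ) (ht : t ∈ Icc 0 S.T) {x : E3}
    {w : Fin M.numNodes → ℝ} (hw : M.IsBary t x w) (i : Fin M.numNodes) :
    M.hat t i x = w i := by
  have h : ∃ w, M.IsBary t x w := ⟨w, hw⟩
  rw [hat, dif_pos h, hM.isBary_unique ht h.choose_spec hw]

theorem ofNodal_eq (hM : M.IsAdmissible ρ) (ht : t ∈ Icc 0 S.T) {x : E3}
    {w : Fin M.numNodes → ℝ} (hw : M.IsBary t x w) (c : Fin M.numNodes → ℝ) :
    M.ofNodal t c x = ∑ i, c i * w i := by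
  simp [ofNodal, hM.hat_eq ht hw]

theorem ofNodal_node (hM : M.IsAdmissible ρ) (ht : t ∈ Icc 0 S.T) (c : Fin M.numNodes → ℝ)
    (j : Fin M.numNodes) : M.ofNodal t c (M.node t j) = c j := by
  classical
  obtain ⟨K, hK, hj⟩ := M.exists_tri j
  have hb : M.IsBary t (M.node t j) (Pi.single j 1) := by
    refine ⟨fun i => ?_, by simp, ⟨K, hK, fun i hi => ?_⟩, by simp [Pi.single_apply, ite_smul]⟩
    · by_cases h : i = j <;> simp [h]
    · have : i ≠ j := fun h => hi (h ▸ hj)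
      simp [this]
  rw [hM.ofNodal_eq ht hb]
  simp [Pi.single_apply]

theorem exists_affineMap (hM : M.IsAdmissible ρ) (ht : t ∈ Icc 0 S.T) (hK : K ∈ M.tris)
    (c : Fin M.numNodes → ℝ) : ∃ A : E3 →ᵃ[ℝ] ℝ, ∀ i ∈ K, A (M.node t i) = c i := by
  obtain ⟨i0, hi0⟩ : K.Nonempty := Finset.card_pos.1 (by rw [M.card_tris K hK]; norm_num)
  have hli := (affineIndependent_iff_linearIndependent_vsub ℝ _ ⟨i0, hi0⟩).1
    (hM.affineIndependent t ht K hK)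
  let l := (Module.Basis.span hli).constr ℝ fun i => c i.1.1 - c i0
  obtain ⟨L, hL⟩ := LinearMap.exists_extend l
  refine ⟨L.toAffineMap + AffineMap.const ℝ E3 (c i0 - L (M.node t i0)), fun i hi => ?_⟩
  by_cases h : i = i0
  · subst h; simp
  · have h' : (⟨i, hi⟩ : {i // i ∈ K}) ≠ ⟨i0, hi0⟩ := fun e => h (congrArg Subtype.val e)
    have e1 := (Module.Basis.span hli).constr_basis ℝ (fun i => c i.1.1 - c i0) ⟨⟨i, hi⟩, h'⟩
    have e2 := LinearMap.congr_fun hL (Module.Basis.span hli ⟨⟨i, hi⟩, h'⟩)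
    have e3 : L (M.node t i - M.node t i0) = c i - c i0 := by
      rw [← vsub_eq_sub, ← e1]
      change l _ = _ at e1
      rw [← e2, LinearMap.comp_apply, Submodule.subtype_apply, Module.Basis.span_apply]
    rw [map_sub] at e3
    simp only [AffineMap.coe_add, Pi.add_apply, LinearMap.coe_toAffineMap, AffineMap.const_apply]
    linarith

end IsAdmissible

theorem affineMap_sum (A : E3 →ᵃ[ℝ] ℝ) {w : Fin M.numNodes → ℝ} (hw : ∑ i, w i = 1) :
    A (∑ i, w i • M.node t i) = ∑ i, w i * A (M.node t i) := by
  have h : ∀ x, A x = A.linear x + A 0 := fun x => by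
    have := A.map_vadd 0 x
    simpa using this
  rw [h, map_sum]
  simp_rw [h (M.node t _), mul_add, Finset.sum_add_distrib, ← Finset.sum_mul, hw, one_mul, map_smul,
    smul_eq_mul]

namespace IsAdmissible

theorem ofNodal_mem_feSpace (hM : M.IsAdmissible ρ) (ht : t ∈ Icc 0 S.T)
    (c : Fin M.numNodes → ℝ) : M.ofNodal t c ∈ M.feSpace t := by
  have key : ∀ K ∈ M.tris, ∃ A : E3 →ᵃ[ℝ] ℝ, EqOn (M.ofNodal t c) A (M.tri t K) := by
    intro K hK
    obtain ⟨A, hA⟩ := hM.exists_affineMap ht hK c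
    refine ⟨A, fun x hx => ?_⟩
    obtain ⟨w, h0, h1, h2, rfl⟩ := mem_tri_iff.1 hx
    rw [hM.ofNodal_eq ht ⟨h0, h1, ⟨K, hK, h2⟩, rfl⟩, affineMap_sum A h1]
    refine Finset.sum_congr rfl fun i _ => ?_
    by_cases hi : i ∈ K
    · rw [hA i hi, mul_comm]
    · simp [h2 i hi]
  refine ⟨?_, key, fun x hx => ?_⟩
  · have h : M.surface t = ⋃ K : {K // K ∈ M.tris}, M.tri t K.1 := by
      ext; simp [surface]
    rw [h]
    -- Continuity on each member of a finite closed cover suffices.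
    refine (locallyFinite_of_finite _).continuousOn_iUnion (fun K => isCompact_tri.isClosed)
      fun K => ?_
    obtain ⟨A, hA⟩ := key K.1 K.2
    exact A.continuous_of_finiteDimensional.continuousOn.congr hA
  · have : ¬ ∃ w, M.IsBary t x w := fun ⟨w, hw⟩ => hx hw.mem_surface
    simp [ofNodal, hat, this]

theorem ofNodal_of_mem (hM : M.IsAdmissible ρ) (ht : t ∈ Icc 0 S.T) {φ : E3 → ℝ}
    (hφ : φ ∈ M.feSpace t) : M.ofNodal t (fun i => φ (M.node t i)) = φ := by
  funext x
  by_cases hx : x ∈ M.surface t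
  · obtain ⟨K, hK, hx⟩ := mem_iUnion₂.1 hx
    obtain ⟨A, hA⟩ := hφ.2.1 K hK
    rw [hA hx]
    obtain ⟨w, h0, h1, h2, rfl⟩ := mem_tri_iff.1 hx
    rw [hM.ofNodal_eq ht ⟨h0, h1, ⟨K, hK, h2⟩, rfl⟩, affineMap_sum A h1]
    refine Finset.sum_congr rfl fun i _ => ?_
    by_cases hi : i ∈ K
    · rw [hA (node_mem_tri hi), mul_comm]
    · simp [h2 i hi]
  · rw [hφ.2.2 x hx, (hM.ofNodal_mem_feSpace ht _).2.2 x hx]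

theorem eq_of_nodal_eq (hM : M.IsAdmissible ρ) (ht : t ∈ Icc 0 S.T) {φ ψ : E3 → ℝ}
    (hφ : φ ∈ M.feSpace t) (hψ : ψ ∈ M.feSpace t)
    (h : ∀ i, φ (M.node t i) = ψ (M.node t i)) : φ = ψ := by
  rw [← hM.ofNodal_of_mem ht hφ, ← hM.ofNodal_of_mem ht hψ]
  simp only [h]

theorem hat_mem_feSpace (hM : M.IsAdmissible ρ) (ht : t ∈ Icc 0 S.T) (i : Fin M.numNodes) :
    M.hat t i ∈ M.feSpace t := by
  classical
  convert hM.ofNodal_mem_feSpace ht (Pi.single i 1) using 1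
  funext x
  simp [ofNodal, Pi.single_apply]

theorem finiteDimensional_feSpace (hM : M.IsAdmissible ρ) (ht : t ∈ Icc 0 S.T) :
    FiniteDimensional ℝ (M.feSpace t) := by
  let f : M.feSpace t →ₗ[ℝ] (Fin M.numNodes → ℝ) :=
    { toFun := fun φ i => φ.1 (M.node t i)
      map_add' := fun _ _ => rfl
      map_smul' := fun _ _ => rfl }
  refine FiniteDimensional.of_injective f fun φ ψ h => Subtype.ext ?_
  exact hM.eq_of_nodal_eq ht φ.2 ψ.2 fun i => congrFun h i

/-! ### Elementwise gradients -/

theorem isElemGrad_elemGrad (hK : K ∈ M.tris) {φ : E3 → ℝ} (hφ : φ ∈ M.feSpace t) :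
    M.IsElemGrad t K φ (M.elemGrad t K φ) := by
  obtain ⟨A, hA⟩ := hφ.2.1 K hK
  have h := (M.existsUnique_isElemGrad t K hA).exists
  rw [elemGrad, dif_pos h]
  exact h.choose_spec

theorem elemGrad_eq (hK : K ∈ M.tris) {φ : E3 → ℝ} (hφ : φ ∈ M.feSpace t) {g : E3}
    (hg : M.IsElemGrad t K φ g) : M.elemGrad t K φ = g := by
  obtain ⟨A, hA⟩ := hφ.2.1 K hK
  exact (M.existsUnique_isElemGrad t K hA).unique (isElemGrad_elemGrad hK hφ) hg

theorem elemGrad_add (hK : K ∈ M.tris) {φ ψ : E3 → ℝ} (hφ : φ ∈ M.feSpace t)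
    (hψ : ψ ∈ M.feSpace t) :
    M.elemGrad t K (φ + ψ) = M.elemGrad t K φ + M.elemGrad t K ψ := by
  refine elemGrad_eq hK (add_mem hφ hψ) ⟨add_mem (isElemGrad_elemGrad hK hφ).1
    (isElemGrad_elemGrad hK hψ).1, fun x hx y hy => ?_⟩
  rw [inner_add_left, ← (isElemGrad_elemGrad hK hφ).2 x hx y hy,
    ← (isElemGrad_elemGrad hK hψ).2 x hx y hy]
  simp only [Pi.add_apply]
  ring

theorem elemGrad_smul (hK : K ∈ M.tris) (a : ℝ) {φ : E3 → ℝ} (hφ : φ ∈ M.feSpace t) :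
    M.elemGrad t K (a • φ) = a • M.elemGrad t K φ := by
  refine elemGrad_eq hK (Submodule.smul_mem _ a hφ) ⟨Submodule.smul_mem _ a
    (isElemGrad_elemGrad hK hφ).1, fun x hx y hy => ?_⟩
  rw [real_inner_smul_left, ← (isElemGrad_elemGrad hK hφ).2 x hx y hy]
  simp only [Pi.smul_apply, smul_eq_mul]
  ring

/-- The right-hand side involves only weights and nodal values, so it does not change when a
function is transferred to another time. This is what makes gradients at two times comparable. -/
theorem inner_elemGrad_sum (hK : K ∈ M.tris) {φ : E3 → ℝ} (hφ : φ ∈ M.feSpace t)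
    {d : Fin M.numNodes → ℝ} (hd : ∀ i ∉ K, d i = 0) (h0 : ∑ i, d i = 0) :
    ⟪M.elemGrad t K φ, ∑ i, d i • M.node t i⟫ = ∑ i, d i * φ (M.node t i) := by
  obtain ⟨j, hj⟩ : K.Nonempty := Finset.card_pos.1 (by rw [M.card_tris K hK]; norm_num)
  have e1 : ∑ i, d i • M.node t i = ∑ i, d i • (M.node t i - M.node t j) := by
    simp [smul_sub, ← Finset.sum_smul, h0]
  have e2 : ∑ i, d i * φ (M.node t i) = ∑ i, d i * (φ (M.node t i) - φ (M.node t j)) := by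
    simp [mul_sub, ← Finset.sum_mul, h0]
  rw [e1, e2, inner_sum]
  refine Finset.sum_congr rfl fun i _ => ?_
  by_cases hi : i ∈ K
  · rw [real_inner_smul_right, (isElemGrad_elemGrad hK hφ).2 _ (node_mem_tri hj) _
      (node_mem_tri hi)]
  · simp [hd i hi]

end IsAdmissible

/-- Fixed weights of zero sum let an in-plane vector be followed in time as the nodes move. -/
theorem exists_weights_of_mem_vectorSpan {y : E3} (hy : y ∈ vectorSpan ℝ (M.verts t K)) :
    ∃ d : Fin M.numNodes → ℝ, (∀ i ∉ K, d i = 0) ∧ ∑ i, d i = 0 ∧ ∑ i, d i • M.node t i = y := by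
  classical
  rw [vectorSpan_def] at hy
  induction hy using Submodule.span_induction with
  | mem x hx =>
    obtain ⟨_, ⟨i, hi, rfl⟩, _, ⟨j, hj, rfl⟩, rfl⟩ := hx
    refine ⟨Pi.single i 1 - Pi.single j 1, fun k hk => ?_, by simp, ?_⟩
    · have h1 : k ≠ i := fun h => hk (h ▸ hi)
      have h2 : k ≠ j := fun h => hk (h ▸ hj)
      simp [h1, h2]
    · simp [sub_smul, Pi.single_apply, ite_smul]
  | zero => exact ⟨0, by simp, by simp, by simp⟩
  | add x y _ _ hx hy =>
    obtain ⟨d, d1, d2, rfl⟩ := hx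
    obtain ⟨e, e1, e2, rfl⟩ := hy
    exact ⟨d + e, fun i hi => by simp [d1 i hi, e1 i hi], by simp [Finset.sum_add_distrib, d2, e2],
      by simp [add_smul, Finset.sum_add_distrib]⟩
  | smul a x _ hx =>
    obtain ⟨d, d1, d2, rfl⟩ := hx
    exact ⟨a • d, fun i hi => by simp [d1 i hi], by simp [← Finset.mul_sum, d2],
      by simp [Finset.smul_sum, smul_smul]⟩

end EvolvingMesh

/-! ### The evolving surface -/

namespace EvolvingSurface

variable (S : EvolvingSurface)

theorem exists_norm_le : ∃ R : ℝ, 0 ≤ R ∧ ∀ t ∈ Icc 0 S.T, ∀ x ∈ S.Γ₀, ‖S.Φ t x‖ ≤ R := by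
  obtain ⟨R, hR⟩ := (isCompact_Icc.prod S.isSurface.isCompact).exists_bound_of_continuousOn
    S.contDiff_Φ.continuousOn
  exact ⟨max R 0, le_max_right _ _, fun t ht x hx => (hR (t, x) ⟨ht, hx⟩).trans (le_max_left _ _)⟩

/-- The spatial derivative is bounded on the compact set [0,T] × ball, and the mean value inequality
applies because the ball is convex. -/
theorem exists_lipschitz (R : ℝ) : ∃ L : ℝ, 0 ≤ L ∧ ∀ t ∈ Icc 0 S.T,
    ∀ x ∈ Metric.closedBall (0 : E3) R, ∀ y ∈ Metric.closedBall (0 : E3) R,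
      ‖S.V t y - S.V t x‖ ≤ L * ‖y - x‖ := by
  obtain ⟨V', hV, hV'⟩ := S.contDiff_V
  obtain ⟨L, hL⟩ := (isCompact_Icc.prod (isCompact_closedBall (0 : E3) R)).exists_bound_of_continuousOn
    ((hV' 1 (by norm_num)).1.mono (prod_mono_right (subset_univ _)))
  refine ⟨max L 0, le_max_right _ _, fun t ht x hx y hy => ?_⟩
  refine (convex_closedBall (0 : E3) R).norm_image_sub_le_of_norm_fderiv_le (𝕜 := ℝ)
    (fun z _ => ((hV t ht).1.differentiable (by norm_num)).differentiableAt) (fun z hz => ?_) hx hy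
  rw [← norm_iteratedFDeriv_one]
  exact (hL (t, z) ⟨ht, hz⟩).trans (le_max_left _ _)

theorem continuousOn_Φ {t : ℝ} (ht : t ∈ Icc 0 S.T) : ContinuousOn (S.Φ t) S.Γ₀ :=
  S.contDiff_Φ.continuousOn.comp (f := fun x => (t, x)) (by fun_prop) fun _ hx => ⟨ht, hx⟩

theorem isCompact_surface {t : ℝ} (ht : t ∈ Icc 0 S.T) : IsCompact (S.surface t) :=
  S.isSurface.isCompact.image_of_continuousOn (S.continuousOn_Φ ht)

theorem isConnected_surface {t : ℝ} (ht : t ∈ Icc 0 S.T) : IsConnected (S.surface t) :=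
  S.isSurface.isConnected.image _ (S.continuousOn_Φ ht)

end EvolvingSurface

namespace EvolvingMesh

variable {S : EvolvingSurface} {M : EvolvingMesh S} {ρ t : ℝ} {K : Finset (Fin M.numNodes)}

/-! ### Size and area of the triangles -/

theorem tri_subset_closedBall {R : ℝ} (hR : ∀ t ∈ Icc 0 S.T, ∀ x ∈ S.Γ₀, ‖S.Φ t x‖ ≤ R)
    (ht : t ∈ Icc 0 S.T) : M.tri t K ⊆ Metric.closedBall 0 R := by
  refine convexHull_min ?_ (convex_closedBall _ _)
  rintro _ ⟨i, _, rfl⟩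
  simpa [node] using hR t ht _ (M.node₀_mem i)

theorem diam_tri_le_meshSize (ht : t ∈ Icc 0 S.T) (hK : K ∈ M.tris) :
    Metric.diam (M.tri t K) ≤ M.meshSize := by
  obtain ⟨R, hR0, hR⟩ := S.exists_norm_le
  -- All meshes stay in one ball, so the supremum defining the mesh size is finite.
  refine le_csSup ⟨2 * R, ?_⟩ ⟨t, ht, K, hK, rfl⟩
  rintro _ ⟨s, hs, K', _, rfl⟩
  exact (Metric.diam_mono (tri_subset_closedBall hR hs) Metric.isBounded_closedBall).trans
    (Metric.diam_closedBall hR0)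

theorem norm_node_sub_le_meshSize (ht : t ∈ Icc 0 S.T) (hK : K ∈ M.tris) {i j : Fin M.numNodes}
    (hi : i ∈ K) (hj : j ∈ K) : ‖M.node t i - M.node t j‖ ≤ M.meshSize := by
  rw [← dist_eq_norm]
  exact (Metric.dist_le_diam_of_mem isCompact_tri.isBounded (node_mem_tri hi)
    (node_mem_tri hj)).trans (diam_tri_le_meshSize ht hK)

namespace IsAdmissible

theorem meshSize_pos (hM : M.IsAdmissible ρ) (ht : t ∈ Icc 0 S.T) (hK : K ∈ M.tris) :
    0 < M.meshSize := by
  obtain ⟨i, hi, j, hj, hij⟩ := Finset.one_lt_card.1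
    (show 1 < K.card by rw [M.card_tris K hK]; norm_num)
  have h := (hM.affineIndependent t ht K hK).injective.ne
    (a₁ := ⟨i, hi⟩) (a₂ := ⟨j, hj⟩) fun e => hij (congrArg Subtype.val e)
  exact (norm_pos_iff.2 (sub_ne_zero.2 h)).trans_le (norm_node_sub_le_meshSize ht hK hi hj)

theorem exists_inball (hM : M.IsAdmissible ρ) (hρ : 0 < ρ) (ht : t ∈ Icc 0 S.T)
    (hK : K ∈ M.tris) : ∃ c ∈ affineSpan ℝ (M.verts t K), ∃ r : ℝ, 0 < r ∧
      ρ * M.meshSize ≤ 4 * r ∧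
      Metric.closedBall c r ∩ (affineSpan ℝ (M.verts t K) : Set E3) ⊆ M.tri t K := by
  have h0 : 0 < ρ * M.meshSize := mul_pos hρ (hM.meshSize_pos ht hK)
  have h1 := hM.quasiUniform t ht K hK
  -- The supremum of the empty set is 0 by convention, which would contradict `h0`. Below, half of
  -- the bound is given up because the supremum need not be attained; hence the 4 instead of 2.
  have hne : {d | ∃ c ∈ affineSpan ℝ (M.verts t K), ∃ r : ℝ, 0 ≤ r ∧ d = 2 * r ∧
      Metric.closedBall c r ∩ (affineSpan ℝ (M.verts t K) : Set E3) ⊆ M.tri t K}.Nonempty := by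
    by_contra h
    rw [not_nonempty_iff_eq_empty] at h
    rw [inDiam, h, Real.sSup_empty] at h1
    linarith
  obtain ⟨d, ⟨c, hc, r, hr, rfl, hsub⟩, hd⟩ := exists_lt_of_lt_csSup hne
    (show ρ * M.meshSize / 2 < _ from (by linarith : _ < ρ * M.meshSize).trans_le h1)
  exact ⟨c, hc, r, by linarith, by linarith, hsub⟩

theorem finrank_vectorSpan (hM : M.IsAdmissible ρ) (ht : t ∈ Icc 0 S.T) (hK : K ∈ M.tris) :
    Module.finrank ℝ (vectorSpan ℝ (M.verts t K)) = 2 := by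
  have h := (hM.affineIndependent t ht K hK).finrank_vectorSpan (n := 2)
    (by simp [M.card_tris K hK])
  have e : M.verts t K = range fun i : {i // i ∈ K} => M.node t i := by
    ext x
    simp [verts]
  rwa [e]

/-- Pulling back along this isometry turns Hausdorff area on the plane of a triangle into Lebesgue
measure, which gives finite and positive areas. -/
theorem exists_isometry_affineSpan (hM : M.IsAdmissible ρ) (ht : t ∈ Icc 0 S.T)
    (hK : K ∈ M.tris) : ∃ j : EuclideanSpace ℝ (Fin 2) → E3, Isometry j ∧
      range j = affineSpan ℝ (M.verts t K) := by
  obtain ⟨i0, hi0⟩ : K.Nonempty := Finset.card_pos.1 (by rw [M.card_tris K hK]; norm_num)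
  have hm : M.node t i0 ∈ affineSpan ℝ (M.verts t K) := mem_affineSpan ℝ ⟨i0, hi0, rfl⟩
  let b := (stdOrthonormalBasis ℝ (vectorSpan ℝ (M.verts t K))).reindex
    (finCongr (hM.finrank_vectorSpan ht hK))
  refine ⟨fun v => (b.repr.symm v : E3) + M.node t i0, Isometry.of_dist_eq fun v w => ?_, ?_⟩
  · rw [dist_add_right, ← Subtype.dist_eq, b.repr.symm.dist_map]
  · ext x
    constructor
    · rintro ⟨v, rfl⟩
      have : (b.repr.symm v : E3) ∈ (affineSpan ℝ (M.verts t K)).direction := by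
        rw [direction_affineSpan]
        exact (b.repr.symm v).2
      exact AffineSubspace.vadd_mem_of_mem_direction this hm
    · intro hx
      have : x - M.node t i0 ∈ vectorSpan ℝ (M.verts t K) := by
        rw [← direction_affineSpan]
        exact AffineSubspace.vsub_mem_direction hx hm
      exact ⟨b.repr ⟨_, this⟩, by simp⟩

theorem area_lt_top (hM : M.IsAdmissible ρ) (ht : t ∈ Icc 0 S.T) (hK : K ∈ M.tris) :
    (μHE[2] : Measure E3) (M.tri t K) < ⊤ := by
  obtain ⟨j, hj, hr⟩ := hM.exists_isometry_affineSpan ht hK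
  have h : M.tri t K ⊆ range j := hr ▸ convexHull_subset_affineSpan _
  rw [← image_preimage_eq_of_subset h, hj.euclideanHausdorffMeasure_image,
    EuclideanSpace.euclideanHausdorffMeasure_eq_volume]
  exact (hj.antilipschitz.isBounded_preimage isCompact_tri.isBounded).measure_lt_top

theorem area_pos (hM : M.IsAdmissible ρ) (hρ : 0 < ρ) (ht : t ∈ Icc 0 S.T) (hK : K ∈ M.tris) :
    0 < (μHE[2] : Measure E3).real (M.tri t K) := by
  refine ENNReal.toReal_pos ?_ (hM.area_lt_top ht hK).ne
  obtain ⟨j, hj, hr⟩ := hM.exists_isometry_affineSpan ht hK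
  obtain ⟨c, hc, r, hr0, -, hsub⟩ := hM.exists_inball hρ ht hK
  rw [← hr] at hsub
  obtain ⟨c, rfl⟩ : c ∈ range j := hr ▸ hc
  have h : j '' Metric.closedBall c r ⊆ M.tri t K := by
    rintro _ ⟨x, hx, rfl⟩
    exact hsub ⟨by rwa [Metric.mem_closedBall, hj.dist_eq], x, rfl⟩
  refine ((measure_mono h).trans_lt' ?_).ne'
  rw [hj.euclideanHausdorffMeasure_image, EuclideanSpace.euclideanHausdorffMeasure_eq_volume]
  exact Metric.measure_closedBall_pos _ _ hr0

theorem area_surface_lt_top (hM : M.IsAdmissible ρ) (ht : t ∈ Icc 0 S.T) :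
    (μHE[2] : Measure E3) (M.surface t) < ⊤ :=
  measure_biUnion_lt_top M.tris.finite_toSet fun _ hK => hM.area_lt_top ht hK

theorem surface_nonempty (hM : M.IsAdmissible ρ) (ht : t ∈ Icc 0 S.T) :
    (M.surface t).Nonempty := by
  obtain ⟨p, hp⟩ := (S.isConnected_surface ht).nonempty
  obtain ⟨x, hx, -⟩ := (hM.exact t ht).surjOn hp
  exact ⟨x, hx⟩

theorem area_surface_pos (hM : M.IsAdmissible ρ) (hρ : 0 < ρ) (ht : t ∈ Icc 0 S.T) :
    0 < (μHE[2] : Measure E3).real (M.surface t) := by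
  obtain ⟨x, hx⟩ := hM.surface_nonempty ht
  obtain ⟨K, hK, -⟩ := mem_iUnion₂.1 hx
  exact (hM.area_pos hρ ht hK).trans_le (measureReal_mono (tri_subset_surface hK)
    (hM.area_surface_lt_top ht).ne)

/-! ### Connectedness of the triangulated surface -/

theorem isPreconnected_surface (hM : M.IsAdmissible ρ) (ht : t ∈ Icc 0 S.T) :
    IsPreconnected (M.surface t) := by
  obtain ⟨r, ⟨-, htube⟩, hr⟩ := hM.tubular t ht
  have hproj : ∀ x ∈ M.surface t, normalProj (S.surface t) x ∈ S.surface t ∧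
      dist x (normalProj (S.surface t) x) = Metric.infDist x (S.surface t) := by
    intro x hx
    have h := (htube x (hr x hx)).exists
    rw [normalProj, dif_pos h]
    exact h.choose_spec
  -- The graph of the projection is closed, hence compact. Its second coordinate is a continuous
  -- bijection onto Γ(t), so a homeomorphism, and its first coordinate carries connectedness to
  -- Γ_h(t). Continuity of the projection itself is not needed.
  let G : Set (E3 × E3) := (M.surface t ×ˢ S.surface t) ∩
    {q | dist q.1 q.2 = Metric.infDist q.1 (S.surface t)}
  have hG : IsCompact G := (isCompact_surface.prod (S.isCompact_surface ht)).inter_right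
    (isClosed_eq (by fun_prop) ((Metric.continuous_infDist_pt _).comp continuous_fst))
  have hGp : ∀ q ∈ G, q.2 = normalProj (S.surface t) q.1 := fun q hq =>
    (htube q.1 (hr _ hq.1.1)).unique ⟨hq.1.2, hq.2⟩ (hproj _ hq.1.1)
  have : CompactSpace G := isCompact_iff_compactSpace.1 hG
  let F : G → S.surface t := fun q => ⟨q.1.2, q.2.1.2⟩
  have hF : Function.Bijective F := by
    constructor
    · intro q q' h
      have h2 : q.1.2 = q'.1.2 := congrArg Subtype.val h
      refine Subtype.ext (Prod.ext ((hM.exact t ht).injOn q.2.1.1 q'.2.1.1 ?_) h2)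
      rw [← hGp _ q.2, ← hGp _ q'.2, h2]
    · rintro ⟨p, hp⟩
      obtain ⟨x, hx, rfl⟩ := (hM.exact t ht).surjOn hp
      exact ⟨⟨(x, _), ⟨hx, (hproj x hx).1⟩, (hproj x hx).2⟩, rfl⟩
  have hFc : Continuous (Equiv.ofBijective F hF) := by
    change Continuous F
    fun_prop
  have hconn : PreconnectedSpace (S.surface t) :=
    isPreconnected_iff_preconnectedSpace.1 (S.isConnected_surface ht).isPreconnected
  have hGc : PreconnectedSpace G :=
    hFc.homeoOfEquivCompactToT2.symm.surjective.denseRange.preconnectedSpace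
      hFc.homeoOfEquivCompactToT2.symm.continuous
  have himg : Prod.fst '' G = M.surface t := by
    ext x
    constructor
    · rintro ⟨q, hq, rfl⟩
      exact hq.1.1
    · intro hx
      exact ⟨(x, _), ⟨⟨hx, (hproj x hx).1⟩, (hproj x hx).2⟩, rfl⟩
  rw [← himg]
  exact (isPreconnected_iff_preconnectedSpace.2 hGc).image _ continuous_fst.continuousOn

/-! ### Integrals of finite element functions -/

theorem integrableOn_feSpace (hM : M.IsAdmissible ρ) (ht : t ∈ Icc 0 S.T) {φ : E3 → ℝ}
    (hφ : φ ∈ M.feSpace t) : IntegrableOn φ (M.surface t) (μHE[2] : Measure E3) := by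
  obtain ⟨C, hC⟩ := isCompact_surface.exists_bound_of_continuousOn hφ.1
  exact IntegrableOn.of_bound (hM.area_surface_lt_top ht)
    (hφ.1.aestronglyMeasurable isCompact_surface.measurableSet) C
    (ae_restrict_of_forall_mem isCompact_surface.measurableSet hC)

theorem integral_add (hM : M.IsAdmissible ρ) (ht : t ∈ Icc 0 S.T) {φ ψ : E3 → ℝ}
    (hφ : φ ∈ M.feSpace t) (hψ : ψ ∈ M.feSpace t) :
    M.integral t (φ + ψ) = M.integral t φ + M.integral t ψ :=
  MeasureTheory.integral_add (hM.integrableOn_feSpace ht hφ) (hM.integrableOn_feSpace ht hψ)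

end IsAdmissible

theorem integral_smul (a : ℝ) (φ : E3 → ℝ) : M.integral t (a • φ) = a * M.integral t φ :=
  MeasureTheory.integral_const_mul a φ

theorem hat_nonneg (i : Fin M.numNodes) (x : E3) : 0 ≤ M.hat t i x := by
  rw [hat]
  split_ifs with h
  · exact h.choose_spec.1 i
  · exact le_rfl

theorem integral_hat_nonneg (i : Fin M.numNodes) : 0 ≤ M.integral t (M.hat t i) :=
  setIntegral_nonneg isCompact_surface.measurableSet fun _ _ => hat_nonneg _ _

namespace IsAdmissible

theorem integral_ofNodal (hM : M.IsAdmissible ρ) (ht : t ∈ Icc 0 S.T)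
    (c : Fin M.numNodes → ℝ) :
    M.integral t (M.ofNodal t c) = ∑ i, M.integral t (M.hat t i) * c i := by
  simp only [integral, ofNodal]
  rw [integral_finsetSum _ fun i _ =>
    (hM.integrableOn_feSpace ht (hM.hat_mem_feSpace ht i)).const_mul _]
  exact Finset.sum_congr rfl fun i _ => by rw [integral_const_mul, mul_comm]

theorem integral_eq_sum (hM : M.IsAdmissible ρ) (ht : t ∈ Icc 0 S.T) {φ : E3 → ℝ}
    (hφ : φ ∈ M.feSpace t) :
    M.integral t φ = ∑ i, M.integral t (M.hat t i) * φ (M.node t i) := by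
  conv_lhs => rw [← hM.ofNodal_of_mem ht hφ]
  exact hM.integral_ofNodal ht _

theorem lumped_eq_sum (hM : M.IsAdmissible ρ) (ht : t ∈ Icc 0 S.T) (η ζ : E3 → ℝ) :
    M.lumped t η ζ =
      ∑ i, M.integral t (M.hat t i) * (η (M.node t i) * ζ (M.node t i)) :=
  hM.integral_ofNodal ht _

end IsAdmissible

/-! ### The Dirichlet form -/

theorem dirichlet_eq_sum (η ζ : E3 → ℝ) : M.dirichlet t η ζ = ∑ K ∈ M.tris,
    (μHE[2] : Measure E3).real (M.tri t K) * ⟪M.elemGrad t K η, M.elemGrad t K ζ⟫ := by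
  simp [dirichlet]

theorem dirichlet_comm (η ζ : E3 → ℝ) : M.dirichlet t η ζ = M.dirichlet t ζ η := by
  simp only [dirichlet_eq_sum, real_inner_comm]

theorem dirichlet_self_nonneg (η : E3 → ℝ) : 0 ≤ M.dirichlet t η η := by
  rw [dirichlet_eq_sum]
  exact Finset.sum_nonneg fun K _ => mul_nonneg measureReal_nonneg real_inner_self_nonneg

theorem dirichlet_add_left {η η' : E3 → ℝ} (ζ : E3 → ℝ) (hη : η ∈ M.feSpace t)
    (hη' : η' ∈ M.feSpace t) :
    M.dirichlet t (η + η') ζ = M.dirichlet t η ζ + M.dirichlet t η' ζ := by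
  simp only [dirichlet_eq_sum, ← Finset.sum_add_distrib]
  refine Finset.sum_congr rfl fun K hK => ?_
  rw [IsAdmissible.elemGrad_add hK hη hη', inner_add_left, mul_add]

theorem dirichlet_smul_left (a : ℝ) {η : E3 → ℝ} (ζ : E3 → ℝ) (hη : η ∈ M.feSpace t) :
    M.dirichlet t (a • η) ζ = a * M.dirichlet t η ζ := by
  simp only [dirichlet_eq_sum, Finset.mul_sum]
  refine Finset.sum_congr rfl fun K hK => ?_
  rw [IsAdmissible.elemGrad_smul hK a hη, real_inner_smul_left]
  ring

theorem dirichlet_sub_left {η η' : E3 → ℝ} (ζ : E3 → ℝ) (hη : η ∈ M.feSpace t)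
    (hη' : η' ∈ M.feSpace t) :
    M.dirichlet t (η - η') ζ = M.dirichlet t η ζ - M.dirichlet t η' ζ := by
  rw [sub_eq_add_neg, ← neg_one_smul ℝ η', dirichlet_add_left ζ hη (Submodule.smul_mem _ _ hη'),
    dirichlet_smul_left _ ζ hη', neg_one_mul, sub_eq_add_neg]

theorem two_mul_dirichlet_le {l : ℝ} (hl : 0 < l) (η ζ : E3 → ℝ) :
    2 * M.dirichlet t η ζ ≤ l * M.dirichlet t η η + l⁻¹ * M.dirichlet t ζ ζ := by
  simp only [dirichlet_eq_sum, Finset.mul_sum, ← Finset.sum_add_distrib]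
  refine Finset.sum_le_sum fun K _ => ?_
  set g := M.elemGrad t K η
  set k := M.elemGrad t K ζ
  have h : 2 * ⟪g, k⟫ ≤ l * ⟪g, g⟫ + l⁻¹ * ⟪k, k⟫ := by
    have h1 : 0 ≤ l⁻¹ * ⟪l • g - k, l • g - k⟫ :=
      mul_nonneg (inv_nonneg.2 hl.le) real_inner_self_nonneg
    rw [inner_sub_left, inner_sub_right, inner_sub_right, real_inner_smul_left,
      real_inner_smul_left, real_inner_smul_right, real_inner_smul_right, real_inner_comm g k] at h1
    have h2 : l⁻¹ * l = 1 := inv_mul_cancel₀ hl.ne'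
    have h3 : l⁻¹ * (l * (l * ⟪g, g⟫) - l * ⟪g, k⟫ - (l * ⟪g, k⟫ - ⟪k, k⟫))
        = (l⁻¹ * l) * (l * ⟪g, g⟫ - 2 * ⟪g, k⟫) + l⁻¹ * ⟪k, k⟫ := by ring
    rw [h3, h2] at h1
    linarith
  nlinarith [measureReal_nonneg (μ := (μHE[2] : Measure E3)) (s := M.tri t K)]

namespace IsAdmissible

theorem exists_const_of_dirichlet_eq_zero (hM : M.IsAdmissible ρ) (hρ : 0 < ρ)
    (ht : t ∈ Icc 0 S.T) {φ : E3 → ℝ} (hφ : φ ∈ M.feSpace t) (h : M.dirichlet t φ φ = 0) :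
    ∃ c : ℝ, ∀ x ∈ M.surface t, φ x = c := by
  rw [dirichlet_eq_sum, Finset.sum_eq_zero_iff_of_nonneg fun K _ =>
    mul_nonneg measureReal_nonneg real_inner_self_nonneg] at h
  have hloc : ∀ K ∈ M.tris, ∀ x ∈ M.tri t K, ∀ y ∈ M.tri t K, φ y = φ x := by
    intro K hK x hx y hy
    have h0 : M.elemGrad t K φ = 0 := by
      have := (mul_eq_zero.1 (h K hK)).resolve_left (hM.area_pos hρ ht hK).ne'
      exact inner_self_eq_zero.1 this
    have := (isElemGrad_elemGrad hK hφ).2 x hx y hy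
    rw [h0, inner_zero_left] at this
    linarith
  -- Being constant on each triangle, φ takes only nodal values; a connected subset of ℝ with
  -- finitely many points has at most one.
  have hfin : (φ '' M.surface t).Finite := by
    refine (finite_range fun i => φ (M.node t i)).subset ?_
    rintro _ ⟨x, hx, rfl⟩
    obtain ⟨K, hK, hx⟩ := mem_iUnion₂.1 hx
    obtain ⟨i, hi⟩ : K.Nonempty := Finset.card_pos.1 (by rw [M.card_tris K hK]; norm_num)
    exact ⟨i, hloc K hK x hx _ (node_mem_tri hi)⟩
  have hsub : (φ '' M.surface t).Subsingleton := by
    by_contra hn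
    exact ((hM.isPreconnected_surface ht).image φ hφ.1).infinite_of_nontrivial
      (not_subsingleton_iff.1 hn) hfin
  obtain ⟨x0, hx0⟩ := hM.surface_nonempty ht
  exact ⟨φ x0, fun x hx => hsub (mem_image_of_mem φ hx) (mem_image_of_mem φ hx0)⟩

theorem eq_zero_of_dirichlet_eq_zero (hM : M.IsAdmissible ρ) (hρ : 0 < ρ)
    (ht : t ∈ Icc 0 S.T) {φ : E3 → ℝ} (hφ : φ ∈ M.feSpace t) (h : M.dirichlet t φ φ = 0)
    (hi : M.integral t φ = 0) : φ = 0 := by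
  obtain ⟨c, hc⟩ := hM.exists_const_of_dirichlet_eq_zero hρ ht hφ h
  have hc0 : c = 0 := by
    rw [integral, setIntegral_congr_fun isCompact_surface.measurableSet hc, setIntegral_const,
      smul_eq_mul] at hi
    exact (mul_eq_zero.1 hi).resolve_left (hM.area_surface_pos hρ ht).ne'
  funext x
  by_cases hx : x ∈ M.surface t
  · rw [hc x hx, hc0]; rfl
  · exact hφ.2.2 x hx

theorem elemGrad_ofNodal_const (hM : M.IsAdmissible ρ) (ht : t ∈ Icc 0 S.T) (hK : K ∈ M.tris)
    (c : ℝ) : M.elemGrad t K (M.ofNodal t fun _ => c) = 0 := by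
  have hone : ∀ x ∈ M.tri t K, M.ofNodal t (fun _ => c) x = c := by
    intro x hx
    obtain ⟨w, h0, h1, h2, h3⟩ := mem_tri_iff.1 hx
    rw [hM.ofNodal_eq ht ⟨h0, h1, ⟨K, hK, h2⟩, h3⟩, ← Finset.mul_sum, h1, mul_one]
  refine elemGrad_eq hK (hM.ofNodal_mem_feSpace ht _) ⟨Submodule.zero_mem _, fun x hx y hy => ?_⟩
  rw [hone x hx, hone y hy, sub_self, inner_zero_left]

/-- A vanishing integral, together with zero Dirichlet energy, would force the constant 1 to be
zero. -/
theorem integral_ofNodal_one_pos (hM : M.IsAdmissible ρ) (hρ : 0 < ρ) (ht : t ∈ Icc 0 S.T) :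
    0 < M.integral t (M.ofNodal t fun _ => 1) := by
  refine lt_of_le_of_ne ?_ fun h => ?_
  · rw [hM.integral_ofNodal ht]
    exact Finset.sum_nonneg fun i _ => mul_nonneg (integral_hat_nonneg i) zero_le_one
  · have h0 := hM.eq_zero_of_dirichlet_eq_zero hρ ht (hM.ofNodal_mem_feSpace ht fun _ => 1)
      (by
        rw [dirichlet_eq_sum]
        exact Finset.sum_eq_zero fun K hK => by
          rw [hM.elemGrad_ofNodal_const ht hK, inner_zero_left, mul_zero]) h.symm
    obtain ⟨x, hx⟩ := hM.surface_nonempty ht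
    obtain ⟨w, hw⟩ := exists_isBary hx
    have := congrFun h0 x
    rw [hM.ofNodal_eq ht hw] at this
    simp [hw.2.1] at this

/-! ### The inverse Laplacian -/

theorem existsUnique_isInvLap (hM : M.IsAdmissible ρ) (hρ : 0 < ρ) (ht : t ∈ Icc 0 S.T)
    {z : E3 → ℝ} (hz : z ∈ M.feSpace t) (hz0 : M.integral t z = 0) :
    ∃! G, M.IsInvLap t z G := by
  have := hM.finiteDimensional_feSpace ht
  -- The product of integrals removes the constants from the kernel of the Dirichlet form, so in
  -- finite dimension injectivity gives solvability. Testing with 1 later shows that the added term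
  -- vanishes at the solution.
  let B : M.feSpace t →ₗ[ℝ] Module.Dual ℝ (M.feSpace t) :=
    LinearMap.mk₂ ℝ (fun η ζ => M.dirichlet t η.1 ζ.1 + M.integral t η.1 * M.integral t ζ.1)
      (fun η η' ζ => by
        simp only [Submodule.coe_add]
        rw [dirichlet_add_left _ η.2 η'.2, hM.integral_add ht η.2 η'.2]; ring)
      (fun a η ζ => by
        simp only [Submodule.coe_smul, smul_eq_mul]
        rw [dirichlet_smul_left _ _ η.2, integral_smul]; ring)
      (fun η ζ ζ' => by
        simp only [Submodule.coe_add]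
        rw [dirichlet_comm, dirichlet_add_left _ ζ.2 ζ'.2, hM.integral_add ht ζ.2 ζ'.2,
          dirichlet_comm, dirichlet_comm ζ'.1]; ring)
      (fun a η ζ => by
        simp only [Submodule.coe_smul, smul_eq_mul]
        rw [dirichlet_comm, dirichlet_smul_left _ _ ζ.2, integral_smul, dirichlet_comm]; ring)
  have hB : ∀ η ζ, B η ζ = M.dirichlet t η.1 ζ.1 + M.integral t η.1 * M.integral t ζ.1 :=
    fun _ _ => rfl
  have hinj : Function.Injective B := by
    rw [← LinearMap.ker_eq_bot, LinearMap.ker_eq_bot']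
    intro η hη
    have h := LinearMap.congr_fun hη η
    rw [hB, LinearMap.zero_apply] at h
    have h1 := dirichlet_self_nonneg (M := M) (t := t) η.1
    have h2 := mul_self_nonneg (M.integral t η.1)
    exact Subtype.ext (hM.eq_zero_of_dirichlet_eq_zero hρ ht η.2 (by linarith)
      (mul_self_eq_zero.1 (by linarith)))
  have hsurj : Function.Surjective B :=
    (LinearMap.injective_iff_surjective_of_finrank_eq_finrank
      Subspace.dual_finrank_eq.symm).1 hinj
  let l : Module.Dual ℝ (M.feSpace t) :=
    { toFun := fun φ => M.lumped t z φ.1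
      map_add' := fun φ ψ => by
        simp only [hM.lumped_eq_sum ht, Submodule.coe_add, Pi.add_apply, mul_add,
          Finset.sum_add_distrib]
      map_smul' := fun a φ => by
        simp only [hM.lumped_eq_sum ht, Submodule.coe_smul, Pi.smul_apply, smul_eq_mul,
          Finset.mul_sum, RingHom.id_apply]
        exact Finset.sum_congr rfl fun i _ => by ring }
  obtain ⟨G, hG⟩ := hsurj l
  have hG' : ∀ φ : M.feSpace t, M.dirichlet t G.1 φ.1 + M.integral t G.1 * M.integral t φ.1
      = M.lumped t z φ.1 := fun φ => LinearMap.congr_fun hG φ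
  have hGi : M.integral t G.1 = 0 := by
    have h := hG' ⟨_, hM.ofNodal_mem_feSpace ht fun _ => 1⟩
    have h1 : M.dirichlet t G.1 (M.ofNodal t fun _ => 1) = 0 := by
      rw [dirichlet_eq_sum]
      exact Finset.sum_eq_zero fun K hK => by
        rw [hM.elemGrad_ofNodal_const ht hK, inner_zero_right, mul_zero]
    have h2 : M.lumped t z (M.ofNodal t fun _ => 1) = 0 := by
      rw [hM.lumped_eq_sum ht, ← hz0, hM.integral_eq_sum ht hz]
      exact Finset.sum_congr rfl fun i _ => by rw [hM.ofNodal_node ht, mul_one]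
    rw [h1, h2, zero_add] at h
    exact (mul_eq_zero.1 h).resolve_right (hM.integral_ofNodal_one_pos hρ ht).ne'
  refine ⟨G.1, ⟨G.2, fun φ hφ => ?_, hGi⟩, fun G' hG2 => ?_⟩
  · have := hG' ⟨φ, hφ⟩
    rwa [hGi, zero_mul, add_zero] at this
  · have hd : ∀ φ ∈ M.feSpace t, M.dirichlet t (G' - G.1) φ = 0 := fun φ hφ => by
      have := hG' ⟨φ, hφ⟩
      rw [hGi, zero_mul, add_zero] at this
      rw [dirichlet_sub_left φ hG2.1 G.2, hG2.2.1 φ hφ, this, sub_self]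
    refine sub_eq_zero.1 (hM.eq_zero_of_dirichlet_eq_zero hρ ht (sub_mem hG2.1 G.2)
      (hd _ (sub_mem hG2.1 G.2)) ?_)
    rw [sub_eq_add_neg, ← neg_one_smul ℝ G.1,
      hM.integral_add ht hG2.1 (Submodule.smul_mem _ _ G.2), integral_smul, hG2.2.2, hGi]
    simp

theorem isInvLap_invLap (hM : M.IsAdmissible ρ) (hρ : 0 < ρ) (ht : t ∈ Icc 0 S.T)
    {z : E3 → ℝ} (hz : z ∈ M.feSpace t) (hz0 : M.integral t z = 0) :
    M.IsInvLap t z (M.invLap t z) := by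
  have h := (hM.existsUnique_isInvLap hρ ht hz hz0).exists
  rw [invLap, dif_pos h]
  exact h.choose_spec

end IsAdmissible

end EvolvingMesh

/-! ### Gronwall estimates in both time directions -/

theorem norm_le_exp_mul_norm_left {E : Type*} [NormedAddCommGroup E] [NormedSpace ℝ E]
    {f f' : ℝ → E} {a b κ : ℝ} (hab : a ≤ b)
    (hf : ∀ t ∈ Icc a b, HasDerivWithinAt f (f' t) (Icc a b) t)
    (hb : ∀ t ∈ Icc a b, ‖f' t‖ ≤ κ * ‖f t‖) : ‖f b‖ ≤ Real.exp (κ * (b - a)) * ‖f a‖ := by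
  have h := norm_le_gronwallBound_of_norm_deriv_right_le (f := f) (f' := f') (δ := ‖f a‖)
    (K := κ) (ε := 0) (fun t ht => (hf t ht).continuousWithinAt)
    (fun t ht => (hf t (Ico_subset_Icc_self ht)).mono_of_mem_nhdsWithin
      (Icc_mem_nhdsGE_of_mem ht)) le_rfl
    (fun t ht => by simpa using hb t (Ico_subset_Icc_self ht)) b ⟨hab, le_rfl⟩
  rwa [gronwallBound_ε0, mul_comm] at h

/-- The hypothesis is invariant under time reversal, so the forward bound applies to r ↦ f(a + b -
r). -/
theorem norm_le_exp_mul_norm_right {E : Type*} [NormedAddCommGroup E] [NormedSpace ℝ E]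
    {f f' : ℝ → E} {a b κ : ℝ} (hab : a ≤ b)
    (hf : ∀ t ∈ Icc a b, HasDerivWithinAt f (f' t) (Icc a b) t)
    (hb : ∀ t ∈ Icc a b, ‖f' t‖ ≤ κ * ‖f t‖) : ‖f a‖ ≤ Real.exp (κ * (b - a)) * ‖f b‖ := by
  have hmaps : MapsTo (fun r => a + b - r) (Icc a b) (Icc a b) := fun r hr =>
    ⟨by linarith [hr.2], by linarith [hr.1]⟩
  have h := norm_le_exp_mul_norm_left (f := fun r => f (a + b - r))
    (f' := fun r => (-1 : ℝ) • f' (a + b - r)) (κ := κ) hab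
    (fun t ht => (hf _ (hmaps ht)).scomp t
      ((hasDerivAt_id t).const_sub (a + b)).hasDerivWithinAt hmaps)
    (fun t ht => by simpa using hb _ (hmaps ht))
  simpa using h

namespace EvolvingMesh

variable {S : EvolvingSurface} {M : EvolvingMesh S} {ρ s t : ℝ} {K : Finset (Fin M.numNodes)}

namespace IsAdmissible

/-! ### Deformation of the triangles -/

/-- Move from the centre of a ball of radius r in K(t) by ±r in the direction of y. Both end points
lie in K(t), so their barycentric coordinates differ by at most 1; this difference is (2r/‖y‖) c. -/
theorem abs_weight_mul_le (hM : M.IsAdmissible ρ) (hρ : 0 < ρ) (ht : t ∈ Icc 0 S.T)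
    (hK : K ∈ M.tris) {c : Fin M.numNodes → ℝ} (hc : ∀ i ∉ K, c i = 0) (h0 : ∑ i, c i = 0)
    (i : Fin M.numNodes) :
    |c i| * (ρ * M.meshSize) ≤ 2 * ‖∑ i, c i • M.node t i‖ := by
  set y := ∑ i, c i • M.node t i with hy
  by_cases hy0 : y = 0
  · simp [hM.eq_zero_of_sum ht hK hc h0 (hy.symm.trans hy0), hy0]
  have hny : 0 < ‖y‖ := norm_pos_iff.2 hy0
  obtain ⟨p, hp, r, hr, hρr, hsub⟩ := hM.exists_inball hρ ht hK
  have hdir : y ∈ (affineSpan ℝ (M.verts t K)).direction := by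
    obtain ⟨j, hj⟩ : K.Nonempty := Finset.card_pos.1 (by rw [M.card_tris K hK]; norm_num)
    have e : y = ∑ i, c i • (M.node t i - M.node t j) := by
      simp [hy, smul_sub, ← Finset.sum_smul, h0]
    rw [e, direction_affineSpan]
    refine Submodule.sum_mem _ fun i _ => ?_
    by_cases hi : i ∈ K
    · exact Submodule.smul_mem _ _ (vsub_mem_vectorSpan ℝ ⟨i, hi, rfl⟩ ⟨j, hj, rfl⟩)
    · simp [hc i hi]
  have hmem : ∀ a : ℝ, |a| * ‖y‖ ≤ r → a • y + p ∈ M.tri t K := fun a ha =>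
    hsub ⟨by simpa [norm_smul] using ha,
      AffineSubspace.vadd_mem_of_mem_direction (Submodule.smul_mem _ a hdir) hp⟩
  have hr' : |r / ‖y‖| * ‖y‖ ≤ r := by
    rw [abs_of_pos (div_pos hr hny), div_mul_cancel₀ _ hny.ne']
  obtain ⟨w, w0, w1, w2, w3⟩ := mem_tri_iff.1 (hmem (r / ‖y‖) hr')
  obtain ⟨v, v0, v1, v2, v3⟩ := mem_tri_iff.1 (hmem (-(r / ‖y‖)) (by rwa [abs_neg]))
  have hcw : w - v - (2 * (r / ‖y‖)) • c = 0 := by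
    refine hM.eq_zero_of_sum ht hK (fun i hi => ?_) ?_ ?_
    · simp [w2 i hi, v2 i hi, hc i hi]
    · simp [Finset.sum_sub_distrib, w1, v1, ← Finset.mul_sum, h0]
    · simp only [Pi.sub_apply, Pi.smul_apply, smul_eq_mul, sub_smul, Finset.sum_sub_distrib, w3, v3,
        mul_smul, ← Finset.smul_sum, ← hy]
      module
  have hi := congrFun hcw i
  simp only [Pi.sub_apply, Pi.smul_apply, smul_eq_mul, Pi.zero_apply] at hi
  have hw1 : w i ≤ 1 := w1 ▸ Finset.single_le_sum (fun j _ => w0 j) (Finset.mem_univ i)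
  have hv1 : v i ≤ 1 := v1 ▸ Finset.single_le_sum (fun j _ => v0 j) (Finset.mem_univ i)
  have habs : |2 * (r / ‖y‖) * c i| ≤ 1 := by
    rw [abs_le]
    constructor <;> linarith [w0 i, v0 i]
  rw [abs_mul, abs_of_pos (by positivity), ← mul_div_assoc, div_mul_eq_mul_div,
    div_le_one hny] at habs
  nlinarith [abs_nonneg (c i)]

end IsAdmissible

/-- `κ` bounds the relative rate of change of in-plane vectors that move with the nodes. -/
def IsStrainBound (M : EvolvingMesh S) (κ : ℝ) : Prop :=
  ∀ K ∈ M.tris, ∀ c : Fin M.numNodes → ℝ, (∀ i ∉ K, c i = 0) → ∑ i, c i = 0 →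
    ∀ t ∈ Icc 0 S.T,
      ‖∑ i, c i • S.V t (M.node t i)‖ ≤ κ * ‖∑ i, c i • M.node t i‖

theorem exists_isStrainBound (S : EvolvingSurface) (hρ : 0 < ρ) :
    ∃ κ : ℝ, 0 ≤ κ ∧ ∀ M : EvolvingMesh S, M.IsAdmissible ρ → M.IsStrainBound κ := by
  obtain ⟨R, -, hR⟩ := S.exists_norm_le
  obtain ⟨L, hL0, hL⟩ := S.exists_lipschitz R
  -- Each of the three nodes contributes at most 2L/ρ: the velocity differences are of order Lh and
  -- the weights of order ‖y‖/(ρh), so h cancels.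
  refine ⟨6 * L / ρ, by positivity, fun M hM K hK c hc h0 t ht => ?_⟩
  obtain ⟨j, hj⟩ : K.Nonempty := Finset.card_pos.1 (by rw [M.card_tris K hK]; norm_num)
  have hball : ∀ i, M.node t i ∈ Metric.closedBall (0 : E3) R := fun i => by
    simpa [node] using hR t ht _ (M.node₀_mem i)
  have e : ∑ i, c i • S.V t (M.node t i)
      = ∑ i ∈ K, c i • (S.V t (M.node t i) - S.V t (M.node t j)) := by
    rw [Finset.sum_subset (Finset.subset_univ K) fun i _ hi => by simp [hc i hi]]
    simp [smul_sub, ← Finset.sum_smul, h0]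
  set y := ∑ i, c i • M.node t i
  have hbound : ∀ i ∈ K, ‖c i • (S.V t (M.node t i) - S.V t (M.node t j))‖ ≤ 2 * L / ρ * ‖y‖ := by
    intro i hi
    have h1 := hL t ht _ (hball j) _ (hball i)
    have h2 := h1.trans (mul_le_mul_of_nonneg_left (norm_node_sub_le_meshSize ht hK hi hj) hL0)
    have h3 := hM.abs_weight_mul_le hρ ht hK hc h0 i
    rw [norm_smul, Real.norm_eq_abs, div_mul_eq_mul_div, le_div_iff₀ hρ]
    calc |c i| * ‖S.V t (M.node t i) - S.V t (M.node t j)‖ * ρ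
        ≤ |c i| * (L * M.meshSize) * ρ := by gcongr
      _ = L * (|c i| * (ρ * M.meshSize)) := by ring
      _ ≤ L * (2 * ‖y‖) := by gcongr
      _ = 2 * L * ‖y‖ := by ring
  rw [e]
  refine (norm_sum_le _ _).trans ((Finset.sum_le_sum hbound).trans (le_of_eq ?_))
  rw [Finset.sum_const, M.card_tris K hK, nsmul_eq_mul]
  push_cast
  ring

theorem hasDerivWithinAt_sum (c : Fin M.numNodes → ℝ) (hs : 0 ≤ s) {b : ℝ} (hb : b ≤ S.T)
    (ht : t ∈ Icc s b) :
    HasDerivWithinAt (fun t => ∑ i, c i • M.node t i) (∑ i, c i • S.V t (M.node t i))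
      (Icc s b) t :=
  HasDerivWithinAt.fun_sum fun i _ => ((S.flow _ (M.node₀_mem i) t
    ⟨hs.trans ht.1, ht.2.trans hb⟩).mono (Icc_subset_Icc hs hb)).const_smul (c i)

namespace IsStrainBound

variable {κ : ℝ}

theorem norm_sum_le_left (hκ : M.IsStrainBound κ) (hs : 0 ≤ s) (hst : s ≤ t) (ht : t ≤ S.T)
    (hK : K ∈ M.tris) {c : Fin M.numNodes → ℝ} (hc : ∀ i ∉ K, c i = 0) (h0 : ∑ i, c i = 0) :
    ‖∑ i, c i • M.node t i‖ ≤ Real.exp (κ * (t - s)) * ‖∑ i, c i • M.node s i‖ :=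
  norm_le_exp_mul_norm_left (f := fun t => ∑ i, c i • M.node t i) hst
    (fun _ hr => hasDerivWithinAt_sum c hs ht hr)
    fun r hr => hκ K hK c hc h0 r ⟨hs.trans hr.1, hr.2.trans ht⟩

theorem norm_sum_le_right (hκ : M.IsStrainBound κ) (hs : 0 ≤ s) (hst : s ≤ t) (ht : t ≤ S.T)
    (hK : K ∈ M.tris) {c : Fin M.numNodes → ℝ} (hc : ∀ i ∉ K, c i = 0) (h0 : ∑ i, c i = 0) :
    ‖∑ i, c i • M.node s i‖ ≤ Real.exp (κ * (t - s)) * ‖∑ i, c i • M.node t i‖ :=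
  norm_le_exp_mul_norm_right (f := fun t => ∑ i, c i • M.node t i) hst
    (fun _ hr => hasDerivWithinAt_sum c hs ht hr)
    fun r hr => hκ K hK c hc h0 r ⟨hs.trans hr.1, hr.2.trans ht⟩

/-- The affine map sending the nodes at time t to those at time s is Lipschitz with constant
exp(κ(t-s)), and two-dimensional measure scales by its square. -/
theorem area_le (hκ : M.IsStrainBound κ) (hM : M.IsAdmissible ρ) (hs : 0 ≤ s) (hst : s ≤ t)
    (ht : t ≤ S.T) (hK : K ∈ M.tris) :
    (μHE[2] : Measure E3).real (M.tri s K)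
      ≤ Real.exp (κ * (t - s)) ^ 2 * (μHE[2] : Measure E3).real (M.tri t K) := by
  have htm : t ∈ Icc 0 S.T := ⟨hs.trans hst, ht⟩
  let F : E3 → E3 := fun x => ∑ i, M.hat t i x • M.node s i
  have hF : ∀ w : Fin M.numNodes → ℝ, (∀ i, 0 ≤ w i) → ∑ i, w i = 1 → (∀ i ∉ K, w i = 0) →
      F (∑ i, w i • M.node t i) = ∑ i, w i • M.node s i := fun w w0 w1 w2 => by
    simp only [F, hM.hat_eq htm ⟨w0, w1, ⟨K, hK, w2⟩, rfl⟩]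
  have hlip : LipschitzOnWith (Real.toNNReal (Real.exp (κ * (t - s)))) F (M.tri t K) := by
    refine LipschitzOnWith.of_dist_le_mul fun x hx y hy => ?_
    obtain ⟨w, w0, w1, w2, rfl⟩ := mem_tri_iff.1 hx
    obtain ⟨v, v0, v1, v2, rfl⟩ := mem_tri_iff.1 hy
    rw [hF w w0 w1 w2, hF v v0 v1 v2, Real.coe_toNNReal _ (Real.exp_pos _).le, dist_eq_norm,
      dist_eq_norm, ← Finset.sum_sub_distrib, ← Finset.sum_sub_distrib]
    simp only [← sub_smul]
    exact hκ.norm_sum_le_right hs hst ht hK (c := fun i => w i - v i)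
      (fun i hi => by simp [w2 i hi, v2 i hi]) (by simp [Finset.sum_sub_distrib, w1, v1])
  have himg : M.tri s K ⊆ F '' M.tri t K := by
    intro x hx
    obtain ⟨w, w0, w1, w2, rfl⟩ := mem_tri_iff.1 hx
    exact ⟨_, mem_tri_iff.2 ⟨w, w0, w1, w2, rfl⟩, hF w w0 w1 w2⟩
  have hle : (μHE[2] : Measure E3) (M.tri s K)
      ≤ ENNReal.ofReal (Real.exp (κ * (t - s))) ^ 2 * (μHE[2] : Measure E3) (M.tri t K) := by
    refine (measure_mono himg).trans ?_
    have h := hlip.hausdorffMeasure_image_le (d := 2) (by norm_num)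
    simp only [Measure.euclideanHausdorffMeasure_def, Measure.smul_apply, Nat.cast_ofNat]
    rw [ENNReal.smul_def, ENNReal.smul_def, smul_eq_mul, smul_eq_mul, mul_left_comm]
    gcongr
    simpa [ENNReal.ofReal] using h
  have htop : ENNReal.ofReal (Real.exp (κ * (t - s))) ^ 2 * (μHE[2] : Measure E3) (M.tri t K)
      ≠ ⊤ := ENNReal.mul_ne_top (by simp) (hM.area_lt_top htm hK).ne
  have := ENNReal.toReal_mono htop hle
  rwa [ENNReal.toReal_mul, ENNReal.toReal_pow, ENNReal.toReal_ofReal (Real.exp_pos _).le] at this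

theorem norm_elemGrad_transfer_le (hκ : M.IsStrainBound κ) (hM : M.IsAdmissible ρ) (hs : 0 ≤ s)
    (hst : s ≤ t) (ht : t ≤ S.T) (hK : K ∈ M.tris) {φ : E3 → ℝ} (hφ : φ ∈ M.feSpace t) :
    ‖M.elemGrad s K (M.transfer t s φ)‖
      ≤ Real.exp (κ * (t - s)) * ‖M.elemGrad t K φ‖ := by
  have hsm : s ∈ Icc 0 S.T := ⟨hs, hst.trans ht⟩
  have hmem : M.transfer t s φ ∈ M.feSpace s := hM.ofNodal_mem_feSpace hsm _
  have hg := IsAdmissible.isElemGrad_elemGrad hK hmem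
  set g := M.elemGrad s K (M.transfer t s φ)
  -- Duality: the gradient g at time s is itself an in-plane vector. Moved to time t, it pairs with
  -- the gradient there to give ‖g‖², while its length grows by at most the strain factor.
  obtain ⟨d, d1, d2, d3⟩ := exists_weights_of_mem_vectorSpan hg.1
  have e1 : ⟪g, g⟫ = ⟪M.elemGrad t K φ, ∑ i, d i • M.node t i⟫ := by
    have e0 := IsAdmissible.inner_elemGrad_sum hK hmem d1 d2
    rw [d3] at e0
    rw [e0, IsAdmissible.inner_elemGrad_sum hK hφ d1 d2]
    exact Finset.sum_congr rfl fun i _ => by rw [transfer, hM.ofNodal_node hsm]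
  have h1 := hκ.norm_sum_le_left hs hst ht hK d1 d2
  rw [d3] at h1
  have h2 := real_inner_le_norm (M.elemGrad t K φ) (∑ i, d i • M.node t i)
  rw [← e1, real_inner_self_eq_norm_mul_norm] at h2
  by_cases hg0 : ‖g‖ = 0
  · rw [hg0]; positivity
  · have hg1 : 0 < ‖g‖ := lt_of_le_of_ne (norm_nonneg _) (Ne.symm hg0)
    refine le_of_mul_le_mul_right (h2.trans ?_) hg1
    calc ‖M.elemGrad t K φ‖ * ‖∑ i, d i • M.node t i‖
        ≤ ‖M.elemGrad t K φ‖ * (Real.exp (κ * (t - s)) * ‖g‖) := by gcongr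
      _ = Real.exp (κ * (t - s)) * ‖M.elemGrad t K φ‖ * ‖g‖ := by ring

theorem dirichlet_transfer_le (hκ : M.IsStrainBound κ) (hM : M.IsAdmissible ρ) (hs : 0 ≤ s)
    (hst : s ≤ t) (ht : t ≤ S.T) {φ : E3 → ℝ} (hφ : φ ∈ M.feSpace t) :
    M.dirichlet s (M.transfer t s φ) (M.transfer t s φ)
      ≤ Real.exp (4 * κ * (t - s)) * M.dirichlet t φ φ := by
  have he : Real.exp (4 * κ * (t - s))
      = Real.exp (κ * (t - s)) ^ 2 * Real.exp (κ * (t - s)) ^ 2 := by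
    rw [← pow_add, ← Real.exp_nat_mul]
    congr 1
    push_cast
    ring
  rw [dirichlet_eq_sum, dirichlet_eq_sum, Finset.mul_sum, he]
  refine Finset.sum_le_sum fun K hK => ?_
  rw [real_inner_self_eq_norm_sq, real_inner_self_eq_norm_sq]
  have h1 := hκ.area_le hM hs hst ht hK
  have h2 := hκ.norm_elemGrad_transfer_le hM hs hst ht hK hφ
  calc _ ≤ (Real.exp (κ * (t - s)) ^ 2 * (μHE[2] : Measure E3).real (M.tri t K))
        * (Real.exp (κ * (t - s)) * ‖M.elemGrad t K φ‖) ^ 2 := by gcongr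
    _ = _ := by ring

end IsStrainBound

end EvolvingMesh

/-! ### Monotonicity of the logarithmic nonlinearity. -/

theorem fLog_sub_mul_sub_nonneg {a b : ℝ} (ha : |a| < 1) (hb : |b| < 1) :
    0 ≤ (fLog a - fLog b) * (a - b) := by
  have hmono : ∀ {x y : ℝ}, |x| < 1 → |y| < 1 → x ≤ y → fLog x ≤ fLog y := by
    intro x y hx hy hxy
    rw [abs_lt] at hx hy
    refine Real.log_le_log (div_pos (by linarith) (by linarith)) ?_
    rw [div_le_div_iff₀ (by linarith) (by linarith)]
    nlinarith
  rcases le_total a b with h | h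
  · exact mul_nonneg_of_nonpos_of_nonpos (sub_nonpos.2 (hmono ha hb h)) (sub_nonpos.2 h)
  · exact mul_nonneg (sub_nonneg.2 (hmono hb ha h)) (sub_nonneg.2 h)

namespace EvolvingMesh

variable {S : EvolvingSurface} {M : EvolvingMesh S} {ρ s t : ℝ}

/-! ### The energy estimate for one time step -/

namespace IsAdmissible

theorem lumped_sub_left (hM : M.IsAdmissible ρ) (ht : t ∈ Icc 0 S.T) (η η' ζ : E3 → ℝ) :
    M.lumped t (η - η') ζ = M.lumped t η ζ - M.lumped t η' ζ := by
  simp only [hM.lumped_eq_sum ht, ← Finset.sum_sub_distrib, Pi.sub_apply]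
  exact Finset.sum_congr rfl fun i _ => by ring

theorem lumped_comm (hM : M.IsAdmissible ρ) (ht : t ∈ Icc 0 S.T) (η ζ : E3 → ℝ) :
    M.lumped t η ζ = M.lumped t ζ η := by
  simp only [hM.lumped_eq_sum ht, mul_comm]

/-- Here z', z are the differences of order parameters at the old and new times, w that of the
chemical potentials, and p that of the logarithmic terms. -/
theorem step_estimate (hM : M.IsAdmissible ρ) (hρ : 0 < ρ) (hs : s ∈ Icc 0 S.T)
    (ht : t ∈ Icc 0 S.T) {ε θ τ q : ℝ} (hε : 0 < ε) (hθ : 0 < θ) (hτ : 0 < τ) (hq : 0 < q)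
    (hdir : ∀ φ ∈ M.feSpace t, M.dirichlet s (M.transfer t s φ) (M.transfer t s φ)
      ≤ q * M.dirichlet t φ φ)
    {z' z w p : E3 → ℝ} (hz' : z' ∈ M.feSpace s) (hz : z ∈ M.feSpace t) (hw : w ∈ M.feSpace t)
    (hz'0 : M.integral s z' = 0) (hz0 : M.integral t z = 0) (hp : 0 ≤ M.lumped t p z)
    (h1 : ∀ φ ∈ M.feSpace t, M.lumped t z φ - M.lumped s z' (M.transfer t s φ)
      = -(τ * M.dirichlet t w φ))
    (h2 : M.lumped t w z = ε * M.dirichlet t z z + θ / (2 * ε) * M.lumped t p z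
      - 1 / ε * M.lumped t z z) :
    (1 - τ / ε ^ 3) * M.negNormSq t z + ε * τ * M.gradNormSq t z ≤ q * M.negNormSq s z' := by
  have hG := hM.isInvLap_invLap hρ ht hz hz0
  have hG' := hM.isInvLap_invLap hρ hs hz' hz'0
  unfold negNormSq gradNormSq
  set G := M.invLap t z
  set G' := M.invLap s z'
  have e1 := h1 G hG.1
  rw [← hG.2.1 G hG.1, ← hG'.2.1 (M.transfer t s G) (hM.ofNodal_mem_feSpace hs _),
    dirichlet_comm w G, hG.2.1 w hw, hM.lumped_comm ht, h2] at e1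
  -- The Young weight q cancels the transfer factor, so one copy of ‖z‖²_{-h} survives on the left.
  have e2 := two_mul_dirichlet_le (M := M) (t := s) hq G' (M.transfer t s G)
  have e3 := mul_le_mul_of_nonneg_left (hdir G hG.1) (inv_nonneg.2 hq.le)
  rw [inv_mul_cancel_left₀ hq.ne'] at e3
  -- With weight ε⁻², the term (2τ/ε) m̄(z, z) consumes exactly half of the available 2ετ‖∇z‖² and
  -- leaves (τ/ε³)‖z‖²_{-h}.
  have e4 := two_mul_dirichlet_le (M := M) (t := t) (show 0 < (ε ^ 2)⁻¹ by positivity) G z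
  rw [hG.2.1 z hz, inv_inv] at e4
  have e5 : 0 ≤ τ * (θ / (2 * ε) * M.lumped t p z) := by positivity
  have e6 := mul_le_mul_of_nonneg_left e4 (show 0 ≤ τ / ε by positivity)
  have e7 : τ / ε * ((ε ^ 2)⁻¹ * M.dirichlet t G G + ε ^ 2 * M.dirichlet t z z)
      = τ / ε ^ 3 * M.dirichlet t G G + ε * τ * M.dirichlet t z z := by
    field_simp
  have e8 : τ / ε * (2 * M.lumped t z z) = 2 * (τ * (1 / ε * M.lumped t z z)) := by ring
  rw [e7, e8] at e6
  linear_combination 2 * e1 + e2 + e3 + 2 * e5 + e6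

theorem lumped_interp_fLog_nonneg (hM : M.IsAdmissible ρ) (ht : t ∈ Icc 0 S.T)
    {u v : E3 → ℝ} (hu : ∀ x ∈ M.surface t, |u x| < 1) (hv : ∀ x ∈ M.surface t, |v x| < 1) :
    0 ≤ M.lumped t ((M.interp t fun x => fLog (u x)) - M.interp t fun x => fLog (v x))
      (u - v) := by
  rw [hM.lumped_eq_sum ht]
  refine Finset.sum_nonneg fun i _ => mul_nonneg (integral_hat_nonneg i) ?_
  simp only [Pi.sub_apply, interp, hM.ofNodal_node ht]
  exact fLog_sub_mul_sub_nonneg (hu _ (node_mem_surface i)) (hv _ (node_mem_surface i))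

end IsAdmissible

/-! ### Consequences of the scheme -/

namespace IsSolution

variable {ε θ τ : ℝ} {NT : ℕ} {U₀ : E3 → ℝ} {U W : ℕ → E3 → ℝ}

theorem mem_feSpace (h : M.IsSolution ε θ τ NT U₀ U W) (h0 : U₀ ∈ M.feSpace 0) {n : ℕ}
    (hn : n ≤ NT) : U n ∈ M.feSpace (n * τ) := by
  rcases Nat.eq_zero_or_pos n with rfl | hpos
  · rw [h.initial, Nat.cast_zero, zero_mul]
    exact h0
  · exact h.mem_U n hpos hn

theorem lumped_sub_lumped (h : M.IsSolution ε θ τ NT U₀ U W) (hM : M.IsAdmissible ρ)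
    (hτ : 0 < τ) (hT : NT * τ = S.T) {n : ℕ} (hn : n + 1 ≤ NT) {φ : E3 → ℝ}
    (hφ : φ ∈ M.feSpace ((n + 1 : ℕ) * τ)) :
    M.lumped ((n + 1 : ℕ) * τ) (U (n + 1)) φ
      - M.lumped (n * τ) (U n) (M.transfer ((n + 1 : ℕ) * τ) (n * τ) φ)
      = -(τ * M.dirichlet ((n + 1 : ℕ) * τ) (W (n + 1)) φ) := by
  have hmem : ∀ m : ℕ, m ≤ NT → (m * τ : ℝ) ∈ Icc 0 S.T := fun m hm =>
    ⟨by positivity, hT ▸ by gcongr⟩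
  -- With zero as old test function, the right-hand side becomes the old mass term tested with the
  -- transferred φ.
  have e := h.eqn_U (n + 1) (by lia) hn 0 (Submodule.zero_mem _) φ hφ
  simp only [Nat.add_sub_cancel] at e
  have e0 : M.lumped (n * τ) (U n) 0 = 0 := by
    simp [hM.lumped_eq_sum (hmem n (by lia))]
  have e1 : M.lumped (n * τ) (U n) (M.transfer ((n + 1 : ℕ) * τ) (n * τ)
      ((1 / τ) • (φ - M.transfer (n * τ) ((n + 1 : ℕ) * τ) 0)))
      = 1 / τ * M.lumped (n * τ) (U n) (M.transfer ((n + 1 : ℕ) * τ) (n * τ) φ) := by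
    simp only [hM.lumped_eq_sum (hmem n (by lia)), transfer, hM.ofNodal_node (hmem n (by lia)),
      Finset.mul_sum, Pi.smul_apply, Pi.sub_apply, hM.ofNodal_node (hmem _ hn), Pi.zero_apply,
      smul_eq_mul, sub_zero]
    exact Finset.sum_congr rfl fun i _ => by ring
  rw [e0, e1, sub_zero] at e
  have e2 := congrArg (τ * ·) e
  simp only [mul_add, ← mul_assoc, mul_one_div_cancel hτ.ne', one_mul] at e2
  linarith

theorem integral_eq (h : M.IsSolution ε θ τ NT U₀ U W) (hM : M.IsAdmissible ρ)
    (h0 : U₀ ∈ M.feSpace 0) (hτ : 0 < τ) (hT : NT * τ = S.T) {n : ℕ} (hn : n ≤ NT) :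
    M.integral (n * τ) (U n) = M.integral 0 U₀ := by
  have hmem : ∀ m : ℕ, m ≤ NT → (m * τ : ℝ) ∈ Icc 0 S.T := fun m hm =>
    ⟨by positivity, hT ▸ by gcongr⟩
  induction n with
  | zero => rw [h.initial, Nat.cast_zero, zero_mul]
  | succ n ih =>
    have e := h.lumped_sub_lumped hM hτ hT hn (hM.ofNodal_mem_feSpace (hmem _ hn) fun _ => 1)
    have e1 : M.dirichlet ((n + 1 : ℕ) * τ) (W (n + 1)) (M.ofNodal ((n + 1 : ℕ) * τ) fun _ => 1)
        = 0 := by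
      rw [dirichlet_eq_sum]
      exact Finset.sum_eq_zero fun K hK => by
        rw [hM.elemGrad_ofNodal_const (hmem _ hn) hK, inner_zero_right, mul_zero]
    rw [← ih (by lia), hM.integral_eq_sum (hmem _ hn) (h.mem_feSpace h0 hn),
      hM.integral_eq_sum (hmem n (by lia)) (h.mem_feSpace h0 (by lia))]
    rw [e1, mul_zero, neg_zero, hM.lumped_eq_sum (hmem _ hn),
      hM.lumped_eq_sum (hmem n (by lia))] at e
    simp only [transfer, hM.ofNodal_node (hmem n (by lia)), hM.ofNodal_node (hmem _ hn),
      mul_one] at e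
    exact sub_eq_zero.1 e

end IsSolution

end EvolvingMesh

/-! ### Discrete Gronwall argument -/

theorem discrete_gronwall {E D : ℕ → ℝ} {κ q : ℝ} {NT : ℕ} (hq : 1 ≤ q) (hκ : 0 ≤ κ)
    (hD : ∀ n, 0 ≤ D n) (h : ∀ n, n + 1 ≤ NT → E (n + 1) + κ * D (n + 1) ≤ q * E n) {N : ℕ}
    (hN : N ≤ NT) : E N + κ * ∑ n ∈ Finset.Icc 1 N, D n ≤ q ^ N * E 0 := by
  induction N with
  | zero => simp
  | succ N ih =>
    rw [Finset.sum_Icc_succ_top (by lia), pow_succ']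
    -- This also multiplies the accumulated sum by q, which is harmless as q ≥ 1 and the sum is
    -- nonnegative.
    have h1 := mul_le_mul_of_nonneg_left (ih (by lia)) (show 0 ≤ q by linarith)
    have h2 : 0 ≤ κ * ∑ n ∈ Finset.Icc 1 N, D n :=
      mul_nonneg hκ (Finset.sum_nonneg fun n _ => hD n)
    nlinarith [h N hN]

/-- Since `T / τ` is an integer, the time step cannot come arbitrarily close to the bound `e`. -/
theorem exists_timeStep_gap {T e : ℝ} (hT : 0 < T) (he : 0 < e) : ∃ δ : ℝ, 0 < δ ∧
    ∀ (τ : ℝ) (NT : ℕ), 0 < τ → NT * τ = T → τ < e → δ ≤ e - τ := by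
  set m := ⌊T / e⌋₊ + 1
  have hm : (0 : ℝ) < m := by positivity
  have hlt : T / e < m := by exact_mod_cast Nat.lt_floor_add_one (T / e)
  refine ⟨e - T / m, sub_pos.2 ?_, fun τ NT hτ hNT hτe => ?_⟩
  · rwa [div_lt_iff₀ hm, mul_comm, ← div_lt_iff₀ he]
  · have h1 : T / e < NT := by
      rw [div_lt_iff₀ he, ← hNT]
      have : (0 : ℝ) < NT := by
        by_contra h0
        nlinarith
      gcongr
    -- The integer T/τ exceeds T/e, hence is at least ⌊T/e⌋ + 1.
    have h2 : m ≤ NT := Nat.succ_le_of_lt ((Nat.floor_lt (by positivity)).2 h1)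
    have h3 : τ ≤ T / m := by
      rw [le_div_iff₀ hm, ← hNT, mul_comm]
      gcongr
    linarith

end ESFEM

/-! ### Proof of the proposition. -/

open ESFEM EvolvingMesh in
theorem mainTheorem10 (S : ESFEM.EvolvingSurface) (ε θ ρ : ℝ) (hε : 0 < ε)
    (hθ : 0 < θ) (hθ1 : θ < 1) (hρ : 0 < ρ) :
    ∃ C : ℝ, 0 < C ∧
      ∀ (M : ESFEM.EvolvingMesh S), M.IsAdmissible ρ →
      ∀ (τ : ℝ) (NT : ℕ), 0 < τ → NT * τ = S.T → τ < ε ^ 3 →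
      ∀ U₀₁ ∈ M.initialData ε θ, ∀ U₀₂ ∈ M.initialData ε θ, M.mean 0 U₀₁ = M.mean 0 U₀₂ →
      ∀ U₁ W₁ U₂ W₂ : ℕ → ESFEM.E3 → ℝ,
        M.IsSolution ε θ τ NT U₀₁ U₁ W₁ → M.IsSolution ε θ τ NT U₀₂ U₂ W₂ →
        (∀ n : ℕ, n ≤ NT → ∃! G, M.IsInvLap (n * τ) (U₁ n - U₂ n) G) ∧
        ∀ N : ℕ, 1 ≤ N → N ≤ NT →
          M.negNormSq (N * τ) (U₁ N - U₂ N)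
              + ε ^ 4 * τ / (ε ^ 3 - τ)
                * ∑ n ∈ Finset.Icc 1 N, M.gradNormSq (n * τ) (U₁ n - U₂ n)
            ≤ Real.exp (C * (N * τ)) * (ε ^ 3 / (ε ^ 3 - τ))
                * M.negNormSq 0 (U₀₁ - U₀₂) := by
  obtain ⟨κ, hκ0, hκ⟩ := exists_isStrainBound S hρ
  obtain ⟨δ, hδ, hgap⟩ := exists_timeStep_gap S.T_pos (show 0 < ε ^ 3 by positivity)
  refine ⟨4 * κ + 1 / δ, by positivity, ?_⟩
  intro M hM τ NT hτ hNT hτε U₀₁ hU₀₁ U₀₂ hU₀₂ hmean U₁ W₁ U₂ W₂ hS₁ hS₂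
  have hmem : ∀ m : ℕ, m ≤ NT → (m * τ : ℝ) ∈ Icc 0 S.T := fun m hm =>
    ⟨by positivity, hNT ▸ by gcongr⟩
  have h0m : (0 : ℝ) ∈ Icc 0 S.T := ⟨le_rfl, S.T_pos.le⟩
  have hint : M.integral 0 U₀₁ = M.integral 0 U₀₂ :=
    (div_left_inj' (hM.area_surface_pos hρ h0m).ne').1 hmean
  have hz : ∀ n ≤ NT, U₁ n - U₂ n ∈ M.feSpace (n * τ) := fun n hn =>
    sub_mem (hS₁.mem_feSpace hU₀₁.1 hn) (hS₂.mem_feSpace hU₀₂.1 hn)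
  have hz0 : ∀ n ≤ NT, M.integral (n * τ) (U₁ n - U₂ n) = 0 := fun n hn => by
    have h2 := hS₂.mem_feSpace hU₀₂.1 hn
    rw [sub_eq_add_neg, ← neg_one_smul ℝ (U₂ n), hM.integral_add (hmem n hn)
      (hS₁.mem_feSpace hU₀₁.1 hn) (Submodule.smul_mem _ _ h2), integral_smul,
      hS₁.integral_eq hM hU₀₁.1 hτ hNT hn, hS₂.integral_eq hM hU₀₂.1 hτ hNT hn, hint]
    ring
  refine ⟨fun n hn => hM.existsUnique_isInvLap hρ (hmem n hn) (hz n hn) (hz0 n hn), ?_⟩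
  intro N _ hN
  have hδτ : δ ≤ ε ^ 3 - τ := hgap τ NT hτ hNT hτε
  have hpos : 0 < ε ^ 3 - τ := sub_pos.2 hτε
  set α := ε ^ 3 / (ε ^ 3 - τ) with hα
  have hα1 : 1 ≤ α := by rw [hα, one_le_div hpos]; linarith
  set q := Real.exp (4 * κ * τ) with hqdef
  have hq1 : 1 ≤ q := Real.one_le_exp (by positivity)
  have hstep : ∀ n, n + 1 ≤ NT →
      M.negNormSq ((n + 1 : ℕ) * τ) (U₁ (n + 1) - U₂ (n + 1))
        + ε ^ 4 * τ / (ε ^ 3 - τ)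
          * M.gradNormSq ((n + 1 : ℕ) * τ) (U₁ (n + 1) - U₂ (n + 1))
        ≤ α * q * M.negNormSq (n * τ) (U₁ n - U₂ n) := by
    intro n hn
    have hn' : n ≤ NT := by lia
    have hle : (n * τ : ℝ) ≤ (n + 1 : ℕ) * τ := by gcongr; lia
    have hdir : ∀ φ ∈ M.feSpace ((n + 1 : ℕ) * τ),
        M.dirichlet (n * τ) (M.transfer ((n + 1 : ℕ) * τ) (n * τ) φ)
          (M.transfer ((n + 1 : ℕ) * τ) (n * τ) φ)
          ≤ q * M.dirichlet ((n + 1 : ℕ) * τ) φ φ := fun φ hφ => by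
      have h := (hκ M hM).dirichlet_transfer_le hM (hmem n hn').1 hle (hmem _ hn).2 hφ
      rwa [show ((n + 1 : ℕ) * τ - n * τ : ℝ) = τ by push_cast; ring] at h
    have hw₁ := hS₁.mem_W (n + 1) (by lia) hn
    have hw₂ := hS₂.mem_W (n + 1) (by lia) hn
    have h := hM.step_estimate hρ (hmem n hn') (hmem _ hn) hε hθ hτ (by positivity) hdir
      (hz n hn') (hz _ hn) (sub_mem hw₁ hw₂) (hz0 n hn') (hz0 _ hn)
      (hM.lumped_interp_fLog_nonneg (hmem _ hn) (hS₁.abs_lt_one _ (by lia) hn)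
        (hS₂.abs_lt_one _ (by lia) hn))
      (fun φ hφ => by
        rw [hM.lumped_sub_left (hmem _ hn), hM.lumped_sub_left (hmem n hn'),
          dirichlet_sub_left φ hw₁ hw₂]
        linear_combination hS₁.lumped_sub_lumped hM hτ hNT hn hφ
          - hS₂.lumped_sub_lumped hM hτ hNT hn hφ)
      (by
        have e₁ := hS₁.eqn_W (n + 1) (by lia) hn _ (hz _ hn)
        have e₂ := hS₂.eqn_W (n + 1) (by lia) hn _ (hz _ hn)
        have e₃ := dirichlet_sub_left (U₁ (n + 1) - U₂ (n + 1))
          (hS₁.mem_feSpace hU₀₁.1 hn) (hS₂.mem_feSpace hU₀₂.1 hn)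
        have e₄ := hM.lumped_sub_left (hmem _ hn) (U₁ (n + 1)) (U₂ (n + 1))
          (U₁ (n + 1) - U₂ (n + 1))
        rw [hM.lumped_sub_left (hmem _ hn) (W₁ (n + 1)),
          hM.lumped_sub_left (hmem _ hn) (M.interp _ _), e₃, e₄]
        linear_combination e₁ - e₂)
    -- Multiplication by α normalises the coefficient 1 - τ/ε³ to 1.
    have h' := mul_le_mul_of_nonneg_left h (show 0 ≤ α by linarith)
    have e1 : α * (1 - τ / ε ^ 3) = 1 := by
      rw [hα]; field_simp
    have e2 : α * (ε * τ) = ε ^ 4 * τ / (ε ^ 3 - τ) := by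
      rw [hα]; ring
    rwa [mul_add, ← mul_assoc, e1, one_mul, ← mul_assoc α (ε * τ), e2, ← mul_assoc α q] at h'
  have hmain := discrete_gronwall
    (E := fun n => M.negNormSq (n * τ) (U₁ n - U₂ n))
    (D := fun n => M.gradNormSq (n * τ) (U₁ n - U₂ n))
    (one_le_mul_of_one_le_of_one_le hα1 hq1) (by positivity)
    (fun n => dirichlet_self_nonneg _) hstep hN
  simp only [Nat.cast_zero, zero_mul, hS₁.initial, hS₂.initial] at hmain
  refine hmain.trans (mul_le_mul_of_nonneg_right ?_ (dirichlet_self_nonneg _))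
  -- Since α - 1 = τ/(ε³-τ) is at most τ/δ, all powers of α go into the exponential.
  have hαexp : α ≤ Real.exp (1 / δ * τ) := by
    have e : α = τ / (ε ^ 3 - τ) + 1 := by rw [hα]; field_simp; ring
    have e' : τ / (ε ^ 3 - τ) ≤ 1 / δ * τ := by
      rw [one_div_mul_eq_div]; gcongr
    rw [e]
    exact (add_le_add_left e' 1).trans (Real.add_one_le_exp _)
  calc (α * q) ^ N ≤ (Real.exp (1 / δ * τ) * q) ^ N := by gcongr
    _ = Real.exp ((4 * κ + 1 / δ) * (N * τ)) := by
      rw [hqdef, ← Real.exp_add, ← Real.exp_nat_mul]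
      congr 1
      ring
    _ ≤ Real.exp ((4 * κ + 1 / δ) * (N * τ)) * α := le_mul_of_one_le_right (Real.exp_pos _).le hα1
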